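/- **Setting.** *Target.* Let $x_{k+1}=f(x_k,w_k)+Gd_k$ ($k\ge 0$), with $x_k\in\mathcal X\subseteq\mathbb R^n$, an arbitrary unknown input $d_k\in\mathbb R^p$, and noise $w_k\in[\underline w,\overline w]\subseteq\mathcal W\subseteq\mathbb R^{n_w}$. Here $f$ is differentiable on $\mathcal X\times\mathcal W$ and its Jacobians satisfy there $J_x\in[\underline J_x,\overline J_x]$ and $J_w\in[\underline J_w,\overline J_w]$ entrywise. Agents $i=1,\dots,N$ measure $y^i_k=C^ix_k+D^iv^i_k+H^id_k$ with $v^i_k\in[\underline v^i,\overline v^i]$. They communicate over a fixed directed graph; $\mathcal N_i\neq\emptyset$ is the set of agents whose data agent $i$ receives. Entrywise, $M^\oplus=\max(M,0)$, $M^\ominus=M^\oplus-M$, $|M|=M^\oplus+M^\ominus$, and inequalities between vectors are componentwise. *Output transformation.* Let $H^i=[U_1^i\ U_2^i]\begin{bmatrix}\Xi^i&0\\0&0\end{bmatrix}[V_1^i\ V_2^i]^\top$ be a singular value decomposition, with $\Xi^i$ diagonal and invertible. Put $C^i_\ell=U_\ell^{i\top}C^i$, $D^i_\ell=U_\ell^{i\top}D^i$,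 $G^i_\ell=GV^i_\ell$, $z^i_{\ell,k}=U_\ell^{i\top}y^i_k$ ($\ell=1,2$). Assume that $C_2^iG_2^i$ has full column rank for every $i$. Put $M_1^i=(\Xi^i)^{-1}$, $M_2^i=(C_2^iG_2^i)^\dagger$, $Q^i=I-G_2^iM_2^iC_2^i$, $\Phi^i=Q^iG_1^iM_1^i$. The gains $\Gamma^i,L^i$ are arbitrary and $T^i=I-\Gamma^iC_2^i$. Put $\Upsilon^i=(V_2^iM_2^iC_2^iG_1^i-V_1^i)M_1^i$, $\Theta^i=-V_2^iM_2^i$, and $$f^i(x,w)=Q^if(x,w)-\Phi^iC_1^ix,\qquad h^i(x,w)=\Upsilon^iC_1^ix+\Theta^iC_2^if(x,w).$$ For a matrix $M$ and $\star\in\{x,w\}$ let $\mathrm{hi}_\star(M)=M^\oplus\overline J_\star-M^\ominus\underline J_\star$ and $\mathrm{lo}_\star(M)=M^\oplus\underline J_\star-M^\ominus\overline J_\star$, which bound $MJ_\star$. Thus the Jacobians of $f^i$ in $x$ and $w$ lie between $\mathrm{lo}_x(Q^i)-\Phi^iC^i_1$ and $\mathrm{hi}_x(Q^i)-\Phi^iC_1^i$,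 respectively between $\mathrm{lo}_w(Q^i)$ and $\mathrm{hi}_w(Q^i)$; those of $h^i$ lie between $\Upsilon^iC^i_1+\mathrm{lo}_x(\Theta^iC^i_2)$ and $\Upsilon^iC^i_1+\mathrm{hi}_x(\Theta^iC^i_2)$, respectively between $\mathrm{lo}_w(\Theta^iC^i_2)$ and $\mathrm{hi}_w(\Theta^iC^i_2)$. Write $f^i=A^ix+B^iw+\rho^i$ and $h^i=A^i_hx+C^i_hw+\mu^i$, where each entry of $A^i,B^i,A^i_h,C^i_h$ is one of the two end points of the corresponding Jacobian bound (a Jacobian sign-stable decomposition). Let $\rho^i_d,\mu^i_d$ be the tight decomposition functions: for $g=\rho^i$ or $\mu^i$, the $s$-th component of $g_d(x_1,w_1,x_2,w_2)$ is $g_s$ evaluated at the point whose coordinates are taken from $(x_1,w_1)$ where the upper bound of the corresponding entry of the $s$-th row of the Jacobian of $g$ (the upper bound above minus the linear part) is positive, and from $(x_2,w_2)$ elsewhere. *Observer.* Let $\tilde A^i=T^iA^i-L^iC_2^i$, $\Psi^i=[\,T^iB^i\ \ -(T^i\Phi^iD_1^i+L^iD_2^i)\ \ -(T^iG_2^iM_2^i+\Gamma^i)D_2^i\,]$,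 $\Lambda^i=[\,C_h^i\ \ \Upsilon^iD_1^i\ \ \Theta^iD_2^i\,]$, $\overline\eta^i=(\overline w,\overline v^i,\overline v^i)$, $\underline\eta^i=(\underline w,\underline v^i,\underline v^i)$, $\zeta^i_{k+1}=T^i\Phi^iz^i_{1,k}+L^iz^i_{2,k}+(T^iG^i_2M^i_2+\Gamma^i)z^i_{2,k+1}$, $\zeta^i_{d,k+1}=-\Theta^iz^i_{2,k+1}-\Upsilon^iz^i_{1,k}$. For a matrix $M$ write $\mathtt M=\begin{bmatrix}M^\oplus&-M^\ominus\\-M^\ominus&M^\oplus\end{bmatrix}$. From arbitrary initial framers with $\underline x^i_0\le x_0\le\overline x^i_0$, the observer computes $$\begin{bmatrix}\overline x^{i,0}_{k+1}\\\underline x^{i,0}_{k+1}\end{bmatrix}=\mathtt{\tilde A}^i\begin{bmatrix}\overline x^i_k\\\underline x^i_k\end{bmatrix}+\mathtt T^i\begin{bmatrix}\rho^i_d(\overline x^i_k,\overline w,\underline x^i_k,\underline w)\\\rho^i_d(\underline x^i_k,\underline w,\overline x^i_k,\overline w)\end{bmatrix}+\mathtt\Psi^i\begin{bmatrix}\overline\eta^i\\\underline\eta^i\end{bmatrix}+\begin{bmatrix}\zeta^i_{k+1}\\\zeta^i_{k+1}\end{bmatrix},$$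 $$\begin{bmatrix}\overline d^{i,0}_{k}\\\underline d^{i,0}_{k}\end{bmatrix}=\mathtt A_h^i\begin{bmatrix}\overline x^i_k\\\underline x^i_k\end{bmatrix}+\begin{bmatrix}\mu^i_d(\overline x^i_k,\overline w,\underline x^i_k,\underline w)\\\mu^i_d(\underline x^i_k,\underline w,\overline x^i_k,\overline w)\end{bmatrix}+\mathtt\Lambda^i\begin{bmatrix}\overline\eta^i\\\underline\eta^i\end{bmatrix}+\begin{bmatrix}\zeta^i_{d,k+1}\\\zeta^i_{d,k+1}\end{bmatrix},$$ with the componentwise network updates $\underline x^i_{k+1}=\max_{j\in\mathcal N_i}\underline x^{j,0}_{k+1}$, $\overline x^i_{k+1}=\min_{j\in\mathcal N_i}\overline x^{j,0}_{k+1}$, $\underline d^i_k=\max_{j\in\mathcal N_i}\underline d^{j,0}_k$, $\overline d^i_k=\min_{j\in\mathcal N_i}\overline d^{j,0}_k$. Let $e_{x,k}\in\mathbb R^{Nn}$ be the stacked vector of the state framer errors $\overline x^i_k-\underline x^i_k$. *Comparison system.* Let $\mathcal A^i_x=|\tilde A^i|+|T^i|\,\overline F^i_{\rho,x}$ with $\overline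 F^i_{\rho,x}=\mathrm{hi}_x(Q^i)^\oplus+\mathrm{lo}_x(Q^i)^\ominus$, and $\mathcal A_x=\operatorname{diag}(\mathcal A_x^1,\dots,\mathcal A_x^N)$. Index coordinates of $\mathbb R^{Nn}$ by pairs $(i,s)$ (agent, state dimension). Let $\Sigma^x$ be the set of binary $Nn\times Nn$ matrices with exactly one $1$ in each row, the one in row $(i,s)$ being in a column $(j,s)$ with $j\in\mathcal N_i$. The noiseless comparison error system is, on the nonnegative orthant, $e_{k+1}=\sigma_k\mathcal A_xe_k$, where $\sigma_k\in\Sigma^x$ has its $1$ of row $(i,s)$ in column $(j^*,s)$, $j^*=\min(\operatorname{argmin}_{j\in\mathcal N_i}(e^0_{k+1})_{(j,s)})$, $e^0_{k+1}=\mathcal A_xe_k$. Its inequality form consists of the sequences $e_k\ge0$ for which there are $e^0_{k+1}\le\mathcal A_xe_k$ with $e_{k+1}\le\sigma_ke^0_{k+1}$ (so $e_{k+1}\le\sigma_k\mathcal A_xe_k$), $\sigma_k$ being selected from $e^0_{k+1}$ by the same rule. Either is globally exponentially stable if there are $c>0$ and $\lambda\in(0,1)$ with $\|e_k\|_2\le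 c\lambda^k\|e_0\|_2$ for all its trajectories and all $k\geq 0$. A matrix is Schur stable if all its complex eigenvalues have modulus less than $1$. **Theorem.** (1) The noiseless comparison error system is globally exponentially stable if and only if there is $\sigma^x_*\in\Sigma^x$ such that $\sigma^x_*\mathcal A_x$ is Schur stable. The same equivalence holds for its inequality form. (2) Consequently, if such a $\sigma^x_*$ exists, the distributed observer is a C-ISS distributed resilient interval observer, that is: * its framers are correct: $\underline x^i_k\le x_k\le\overline x^i_k$ and $\underline d^i_k\le d_k\le\overline d^i_k$ for all $i,k$; * there are $\beta$ of class $\mathcal{KL}$ and $\gamma$ of class $\mathcal K_\infty$ such that $\|e_{x,k}\|_2\le\beta(\|e_{x,0}\|_2,k)+\gamma(\|\Delta\|_2)$ for all $k\ge0$, where $\Delta=(\overline w-\underline w,\ \overline v^1-\underline v^1,\dots,\overline v^N-\underline v^N)$ is the vector of noise interval widths. Both hold for every trajectory of the target, every unknown input, all noise bounds with $[\underline w,\overline w]\subseteq\mathcal W$, all noises within them and all correct initial framers, at every time $k$ up to which the state framer intervals $[\underline x^i_l,\overline x^i_l]$, $l\le k$, are contained in $\mathcal X$ (no restriction if $\mathcal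 X=\mathbb R^n$). The functions $\beta,\gamma$ do not depend on any of these. -/

import Mathlib

open Matrix

noncomputable section

namespace ResilientObserver

/-! ### Vectors, matrices, comparison functions -/

/-- The Euclidean norm of a real vector with an arbitrary finite index set. -/
def l2norm {ι : Type*} [Fintype ι] (v : ι → ℝ) : ℝ :=
  ‖(WithLp.toLp 2 v : EuclideanSpace ℝ ι)‖

/-- `M^⊕ = max(M, 0)`, entrywise. -/
def mPos {m n : Type*} (M : Matrix m n ℝ) : Matrix m n ℝ := M.map fun a => max a 0

/-- `M^⊖ = M^⊕ - M`, entrywise equal to `max(-M, 0)`. -/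
def mNeg {m n : Type*} (M : Matrix m n ℝ) : Matrix m n ℝ := mPos M - M

/-- `|M| = M^⊕ + M^⊖`, the entrywise absolute value. -/
def mAbs {m n : Type*} (M : Matrix m n ℝ) : Matrix m n ℝ := mPos M + mNeg M

/-- A real square matrix is Schur stable if all its complex eigenvalues lie in the open
unit disc. -/
def SchurStable {ι : Type*} [Fintype ι] [DecidableEq ι] (M : Matrix ι ι ℝ) : Prop :=
  ∀ z ∈ spectrum ℂ (M.map Complex.ofReal), ‖z‖ < 1

/-- The Moore–Penrose inverse of a matrix with full column rank. -/
def pinv {m n : Type*} [Fintype m] [Fintype n] [DecidableEq n] (K : Matrix m n ℝ) :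
    Matrix n m ℝ := (Kᵀ * K)⁻¹ * Kᵀ

/-- Class `𝒦` functions on `[0, ∞)`. -/
def ClassK (ρ : ℝ → ℝ) : Prop :=
  ContinuousOn ρ (Set.Ici 0) ∧ StrictMonoOn ρ (Set.Ici 0) ∧ ρ 0 = 0

/-- Class `𝒦_∞` functions on `[0, ∞)`. -/
def ClassKInf (ρ : ℝ → ℝ) : Prop :=
  ClassK ρ ∧ Filter.Tendsto ρ Filter.atTop Filter.atTop

/-- Class `𝒦ℒ` functions on `[0, ∞) × [0, ∞)`. -/
def ClassKL (β : ℝ → ℝ → ℝ) : Prop :=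
  ContinuousOn (Function.uncurry β) (Set.Ici 0 ×ˢ Set.Ici 0) ∧
  (∀ t, 0 ≤ t → ClassK fun r => β r t) ∧
  (∀ r, 0 ≤ r → AntitoneOn (β r) (Set.Ici 0) ∧
    Filter.Tendsto (β r) Filter.atTop (nhds 0))

/-! ### Interval bounds and mixed-monotone decompositions -/

/-- Upper bound `M^⊕ hi - M^⊖ lo` of `M v` over `lo ≤ v ≤ hi`. -/
def boundHi {m n : Type*} [Fintype n] (M : Matrix m n ℝ) (hi lo : n → ℝ) : m → ℝ :=
  mPos M *ᵥ hi - mNeg M *ᵥ lo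

/-- Lower bound `M^⊕ lo - M^⊖ hi` of `M v` over `lo ≤ v ≤ hi`. -/
def boundLo {m n : Type*} [Fintype n] (M : Matrix m n ℝ) (hi lo : n → ℝ) : m → ℝ :=
  mPos M *ᵥ lo - mNeg M *ᵥ hi

/-- Upper bound `M^⊕ hi - M^⊖ lo` of the product `M * J` over matrices `lo ≤ J ≤ hi`. -/
def mulHi {k m n : Type*} [Fintype m] (M : Matrix k m ℝ) (lo hi : Matrix m n ℝ) :
    Matrix k n ℝ := mPos M * hi - mNeg M * lo

/-- Lower bound `M^⊕ lo - M^⊖ hi` of the product `M * J` over matrices `lo ≤ J ≤ hi`. -/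
def mulLo {k m n : Type*} [Fintype m] (M : Matrix k m ℝ) (lo hi : Matrix m n ℝ) :
    Matrix k n ℝ := mPos M * lo - mNeg M * hi

/-- Every entry of `M` is one of the two end points of the corresponding entry interval. -/
def IsEndpointChoice {m n : Type*} (lo hi M : Matrix m n ℝ) : Prop :=
  ∀ i j, M i j = lo i j ∨ M i j = hi i j

/-- The selection pattern `max(sgn J, 0)` (with `sgn 0 = 0`) of an upper Jacobian bound `J` of
a Jacobian sign-stable map: the entry is `1` where the map may increase, `0` otherwise. Row `s`
is the diagonal of the selection matrix used for the `s`-th component. -/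
def selPattern {m n : Type*} (J : Matrix m n ℝ) : Matrix m n ℝ :=
  J.map fun a => max (Real.sign a) 0

/-- The tight mixed-monotone decomposition function: its `s`-th component is the `s`-th component
of `g` evaluated at `D^s z₁ + (I - D^s) z₂`, where `z = (x, w)`, and `D^s` is the diagonal matrix
whose diagonal consists of the `s`-th rows of `Ex` and `Ew`. -/
def decomp {m n nw : ℕ} (g : (Fin n → ℝ) → (Fin nw → ℝ) → (Fin m → ℝ))
    (Ex : Matrix (Fin m) (Fin n) ℝ) (Ew : Matrix (Fin m) (Fin nw) ℝ)
    (x₁ : Fin n → ℝ) (w₁ : Fin nw → ℝ) (x₂ : Fin n → ℝ) (w₂ : Fin nw → ℝ) : Fin m → ℝ :=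
  fun s => g (fun j => Ex s j * x₁ j + (1 - Ex s j) * x₂ j)
    (fun j => Ew s j * w₁ j + (1 - Ew s j) * w₂ j) s

/-! ### The target system and the agents -/

/-- The target `x_{k+1} = f(x_k, w_k) + G d_k` with state domain `X`, noise domain `W` and bounds
on the Jacobian of `f`. -/
structure Target (n p nw : ℕ) where
  f : (Fin n → ℝ) → (Fin nw → ℝ) → (Fin n → ℝ)
  G : Matrix (Fin n) (Fin p) ℝ
  X : Set (Fin n → ℝ)
  W : Set (Fin nw → ℝ)
  JxLo : Matrix (Fin n) (Fin n) ℝ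
  JxHi : Matrix (Fin n) (Fin n) ℝ
  JwLo : Matrix (Fin n) (Fin nw) ℝ
  JwHi : Matrix (Fin n) (Fin nw) ℝ

/-- `f` is differentiable on `X × W`, and the entries of its Jacobians with respect to `x` and `w`
lie between the given bounds there. -/
def Target.HasBoundedJacobian {n p nw : ℕ} (S : Target n p nw) : Prop :=
  ∀ z ∈ S.X ×ˢ S.W, ∃ J : ((Fin n → ℝ) × (Fin nw → ℝ)) →L[ℝ] (Fin n → ℝ),
    HasFDerivWithinAt (fun y : (Fin n → ℝ) × (Fin nw → ℝ) => S.f y.1 y.2) J (S.X ×ˢ S.W) z ∧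
    (∀ s j, J (Pi.single j 1, 0) s ∈ Set.Icc (S.JxLo s j) (S.JxHi s j)) ∧
    (∀ s j, J (0, Pi.single j 1) s ∈ Set.Icc (S.JwLo s j) (S.JwHi s j))

/-- A singular value decomposition `H = [U₁ U₂] [Ξ 0; 0 0] [V₁ V₂]ᵀ` with `U`, `V` orthogonal and
`Ξ = diag ξ` diagonal and invertible (so `r` is the rank of `H`). -/
structure SVD {l p : ℕ} (H : Matrix (Fin l) (Fin p) ℝ) where
  r : ℕ
  l₂ : ℕ
  p₂ : ℕ
  U₁ : Matrix (Fin l) (Fin r) ℝ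
  U₂ : Matrix (Fin l) (Fin l₂) ℝ
  V₁ : Matrix (Fin p) (Fin r) ℝ
  V₂ : Matrix (Fin p) (Fin p₂) ℝ
  ξ : Fin r → ℝ
  ξ_ne_zero : ∀ j, ξ j ≠ 0
  U_left : (fromCols U₁ U₂)ᵀ * fromCols U₁ U₂ = 1
  U_right : fromCols U₁ U₂ * (fromCols U₁ U₂)ᵀ = 1
  V_left : (fromCols V₁ V₂)ᵀ * fromCols V₁ V₂ = 1
  V_right : fromCols V₁ V₂ * (fromCols V₁ V₂)ᵀ = 1
  eq_mul : H = fromCols U₁ U₂ *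
    (fromBlocks (diagonal ξ) 0 0 0 : Matrix (Fin r ⊕ Fin l₂) (Fin r ⊕ Fin p₂) ℝ) *
    (fromCols V₁ V₂)ᵀ

/-- An agent: the measurement `y = C x + D v + H d`, a singular value decomposition of `H`, the free
observer gains `Γ`, `L`, and the linear parts `A`, `B` and `Ah`, `Ch` of the two Jacobian
sign-stable decompositions that the agent uses. -/
structure Agent (n p nw : ℕ) where
  l : ℕ
  nv : ℕ
  C : Matrix (Fin l) (Fin n) ℝ
  D : Matrix (Fin l) (Fin nv) ℝ
  H : Matrix (Fin l) (Fin p) ℝ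
  svd : SVD H
  Γ : Matrix (Fin n) (Fin svd.l₂) ℝ
  L : Matrix (Fin n) (Fin svd.l₂) ℝ
  A : Matrix (Fin n) (Fin n) ℝ
  B : Matrix (Fin n) (Fin nw) ℝ
  Ah : Matrix (Fin p) (Fin n) ℝ
  Ch : Matrix (Fin p) (Fin nw) ℝ

namespace Agent

variable {n p nw : ℕ} (a : Agent n p nw) (S : Target n p nw)

/-! #### Output transformation -/

def C₁ : Matrix (Fin a.svd.r) (Fin n) ℝ := a.svd.U₁ᵀ * a.C
def C₂ : Matrix (Fin a.svd.l₂) (Fin n) ℝ := a.svd.U₂ᵀ * a.C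
def D₁ : Matrix (Fin a.svd.r) (Fin a.nv) ℝ := a.svd.U₁ᵀ * a.D
def D₂ : Matrix (Fin a.svd.l₂) (Fin a.nv) ℝ := a.svd.U₂ᵀ * a.D
def G₁ : Matrix (Fin n) (Fin a.svd.r) ℝ := S.G * a.svd.V₁
def G₂ : Matrix (Fin n) (Fin a.svd.p₂) ℝ := S.G * a.svd.V₂

/-- `C₂ G₂` has full column rank. -/
def FullColumnRank : Prop := (a.C₂ * a.G₂ S).rank = a.svd.p₂

def M₁ : Matrix (Fin a.svd.r) (Fin a.svd.r) ℝ := (diagonal a.svd.ξ)⁻¹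
def M₂ : Matrix (Fin a.svd.p₂) (Fin a.svd.l₂) ℝ := pinv (a.C₂ * a.G₂ S)

/-- `Q = I - G₂ M₂ C₂`, the projection that removes the second input component. -/
def Q : Matrix (Fin n) (Fin n) ℝ := 1 - a.G₂ S * a.M₂ S * a.C₂

def Φ : Matrix (Fin n) (Fin a.svd.r) ℝ := a.Q S * a.G₁ S * a.M₁

/-- `T = I - Γ C₂`. -/
def T : Matrix (Fin n) (Fin n) ℝ := 1 - a.Γ * a.C₂

/-! #### The state map and its Jacobian sign-stable decomposition -/

/-- `fᵢ(x, w) = (I - G₂ M₂ C₂) f(x, w) - Φ C₁ x`, the state map after elimination of the unknown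
input. -/
def fi (x : Fin n → ℝ) (w : Fin nw → ℝ) : Fin n → ℝ :=
  a.Q S *ᵥ S.f x w - (a.Φ S * a.C₁) *ᵥ x

/-- Bounds on the Jacobian of `fᵢ` in `x` and `w`. -/
def fiJxLo : Matrix (Fin n) (Fin n) ℝ := mulLo (a.Q S) S.JxLo S.JxHi - a.Φ S * a.C₁
def fiJxHi : Matrix (Fin n) (Fin n) ℝ := mulHi (a.Q S) S.JxLo S.JxHi - a.Φ S * a.C₁
def fiJwLo : Matrix (Fin n) (Fin nw) ℝ := mulLo (a.Q S) S.JwLo S.JwHi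
def fiJwHi : Matrix (Fin n) (Fin nw) ℝ := mulHi (a.Q S) S.JwLo S.JwHi

/-- The remainder `ρ` in `fᵢ(x, w) = A x + B w + ρ(x, w)`. -/
def ρ (x : Fin n → ℝ) (w : Fin nw → ℝ) : Fin n → ℝ := a.fi S x w - a.A *ᵥ x - a.B *ᵥ w

/-- The tight decomposition function of `ρ`. -/
def ρd : (Fin n → ℝ) → (Fin nw → ℝ) → (Fin n → ℝ) → (Fin nw → ℝ) → (Fin n → ℝ) :=
  decomp (a.ρ S) (selPattern (a.fiJxHi S - a.A)) (selPattern (a.fiJwHi S - a.B))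

/-! #### The input map and its Jacobian sign-stable decomposition -/

def Υ : Matrix (Fin p) (Fin a.svd.r) ℝ :=
  (a.svd.V₂ * a.M₂ S * a.C₂ * a.G₁ S - a.svd.V₁) * a.M₁
def Θ : Matrix (Fin p) (Fin a.svd.l₂) ℝ := -(a.svd.V₂ * a.M₂ S)

/-- `h(x, w) = Υ C₁ x + Θ C₂ f(x, w)`. -/
def h (x : Fin n → ℝ) (w : Fin nw → ℝ) : Fin p → ℝ :=
  (a.Υ S * a.C₁) *ᵥ x + (a.Θ S * a.C₂) *ᵥ S.f x w

/-- Bounds on the Jacobian of `h` in `x` and `w`. -/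
def hJxLo : Matrix (Fin p) (Fin n) ℝ := a.Υ S * a.C₁ + mulLo (a.Θ S * a.C₂) S.JxLo S.JxHi
def hJxHi : Matrix (Fin p) (Fin n) ℝ := a.Υ S * a.C₁ + mulHi (a.Θ S * a.C₂) S.JxLo S.JxHi
def hJwLo : Matrix (Fin p) (Fin nw) ℝ := mulLo (a.Θ S * a.C₂) S.JwLo S.JwHi
def hJwHi : Matrix (Fin p) (Fin nw) ℝ := mulHi (a.Θ S * a.C₂) S.JwLo S.JwHi

/-- The remainder `μ` in `h(x, w) = Ah x + Ch w + μ(x, w)`. -/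
def μ (x : Fin n → ℝ) (w : Fin nw → ℝ) : Fin p → ℝ := a.h S x w - a.Ah *ᵥ x - a.Ch *ᵥ w

/-- The tight decomposition function of `μ`. -/
def μd : (Fin n → ℝ) → (Fin nw → ℝ) → (Fin n → ℝ) → (Fin nw → ℝ) → (Fin p → ℝ) :=
  decomp (a.μ S) (selPattern (a.hJxHi S - a.Ah)) (selPattern (a.hJwHi S - a.Ch))

/-- The linear parts `A`, `B`, `Ah`, `Ch` are chosen, entry by entry, as end points of the Jacobian
bounds of `fᵢ` and `h`. -/
def IsJSSDecomposition : Prop :=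
  IsEndpointChoice (a.fiJxLo S) (a.fiJxHi S) a.A ∧
  IsEndpointChoice (a.fiJwLo S) (a.fiJwHi S) a.B ∧
  IsEndpointChoice (a.hJxLo S) (a.hJxHi S) a.Ah ∧
  IsEndpointChoice (a.hJwLo S) (a.hJwHi S) a.Ch

/-! #### Observer matrices -/

/-- `T A - L C₂`. -/
def Atilde : Matrix (Fin n) (Fin n) ℝ := a.T * a.A - a.L * a.C₂

/-- `Ψ = [T B, -(T Φ D₁ + L D₂), -(T G₂ M₂ + Γ) D₂]`, acting on `η = (w_k, v_k, v_{k+1})`. -/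
def Ψ : Matrix (Fin n) ((Fin nw ⊕ Fin a.nv) ⊕ Fin a.nv) ℝ :=
  fromCols (fromCols (a.T * a.B) (-(a.T * a.Φ S * a.D₁ + a.L * a.D₂)))
    (-((a.T * a.G₂ S * a.M₂ S + a.Γ) * a.D₂))

/-- `Λ = [Ch, Υ D₁, Θ D₂]`, acting on `η = (w_k, v_k, v_{k+1})`. -/
def Λ : Matrix (Fin p) ((Fin nw ⊕ Fin a.nv) ⊕ Fin a.nv) ℝ :=
  fromCols (fromCols a.Ch (a.Υ S * a.D₁)) (a.Θ S * a.D₂)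

/-- `(w, v, v)` as one vector. -/
def ηvec (w : Fin nw → ℝ) (v : Fin a.nv → ℝ) : (Fin nw ⊕ Fin a.nv) ⊕ Fin a.nv → ℝ :=
  Sum.elim (Sum.elim w v) v

/-- `ζ_{k+1} = T Φ z₁_k + L z₂_k + (T G₂ M₂ + Γ) z₂_{k+1}` with `z = Uᵀ y`, as a function of
`y = y_k` and `y' = y_{k+1}`. -/
def ζ (y y' : Fin a.l → ℝ) : Fin n → ℝ :=
  (a.T * a.Φ S) *ᵥ (a.svd.U₁ᵀ *ᵥ y) + a.L *ᵥ (a.svd.U₂ᵀ *ᵥ y) +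
    (a.T * a.G₂ S * a.M₂ S + a.Γ) *ᵥ (a.svd.U₂ᵀ *ᵥ y')

/-- `ζ_{d,k+1} = -Θ z₂_{k+1} - Υ z₁_k`, as a function of `y = y_k` and `y' = y_{k+1}`. -/
def ζd (y y' : Fin a.l → ℝ) : Fin p → ℝ :=
  -(a.Θ S *ᵥ (a.svd.U₂ᵀ *ᵥ y')) - a.Υ S *ᵥ (a.svd.U₁ᵀ *ᵥ y)

/-- `F̄_{ρ,x} = J̄^⊕ + J̲^⊖` for the bounds `J̲, J̄` on the `x`-Jacobian of `(I - G₂ M₂ C₂) f`. -/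
def Fρx : Matrix (Fin n) (Fin n) ℝ :=
  mPos (mulHi (a.Q S) S.JxLo S.JxHi) + mNeg (mulLo (a.Q S) S.JxLo S.JxHi)

/-- `𝒜_xⁱ = |T A - L C₂| + |T| F̄_{ρ,x}`. -/
def Ax : Matrix (Fin n) (Fin n) ℝ := mAbs a.Atilde + mAbs a.T * a.Fρx S

end Agent

/-! ### The switched comparison error system -/

section Network

variable {N n p nw : ℕ}

/-- `𝒩_i`: the agents whose data agent `i` receives, `(j, i)` being an edge. -/
def nbr (graph : Digraph (Fin N)) (i : Fin N) : Set (Fin N) := {j | graph.Adj j i}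

/-- `𝒜_x = diag(𝒜_x¹, …, 𝒜_xᴺ)`; the coordinate `(i, s)` is state dimension `s` at node `i`. -/
def collectiveAx (S : Target n p nw) (agent : Fin N → Agent n p nw) :
    Matrix (Fin N × Fin n) (Fin N × Fin n) ℝ :=
  Matrix.of fun a b => if a.1 = b.1 then (agent a.1).Ax S a.2 b.2 else 0

/-- `Σˣ`: binary matrices with exactly one `1` in each row, the one in row `(i, s)` being in a
column `(j, s)` with `j ∈ 𝒩_i`. -/
def SigmaX (n : ℕ) (graph : Digraph (Fin N)) :
    Set (Matrix (Fin N × Fin n) (Fin N × Fin n) ℝ) :=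
  {σ | (∀ a b, σ a b = 0 ∨ σ a b = 1) ∧
    (∀ a b, ¬ (b.1 ∈ nbr graph a.1 ∧ b.2 = a.2) → σ a b = 0) ∧
    (∀ a, ∑ b, σ a b = 1)}

/-- `σ` selects at `(i, s)` the neighbour with the smallest error: the entry at `(i, s), (j, s)` is
`1` exactly if `j = min (argmin_{j ∈ 𝒩_i} (e⁰ʲ)_s)`. -/
def IsMinSelection (graph : Digraph (Fin N)) (e0 : Fin N × Fin n → ℝ)
    (σ : Matrix (Fin N × Fin n) (Fin N × Fin n) ℝ) : Prop :=
  σ ∈ SigmaX n graph ∧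
  ∀ (i j : Fin N) (s : Fin n), σ (i, s) (j, s) = 1 ↔
    IsLeast {j' | j' ∈ nbr graph i ∧ ∀ j'' ∈ nbr graph i, e0 (j', s) ≤ e0 (j'', s)} j

/-- A trajectory of the noiseless switched comparison system `e_{k+1} = σ_k 𝒜 e_k`, `e_k ≥ 0`, the
switching signal selecting the smallest entries of `e⁰_{k+1} = 𝒜 e_k`. -/
def IsComparisonTrajectory (graph : Digraph (Fin N))
    (A : Matrix (Fin N × Fin n) (Fin N × Fin n) ℝ) (e : ℕ → Fin N × Fin n → ℝ) : Prop :=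
  (∀ k, 0 ≤ e k) ∧
  ∃ σ : ℕ → Matrix (Fin N × Fin n) (Fin N × Fin n) ℝ, ∀ k,
    IsMinSelection graph (A *ᵥ e k) (σ k) ∧ e (k + 1) = (σ k * A) *ᵥ e k

/-- A trajectory of the noiseless switched comparison inequality `e_{k+1} ≤ σ_k 𝒜 e_k`, `e_k ≥ 0`:
the switching signal selects the smallest entries of the local errors `e⁰_{k+1} ≤ 𝒜 e_k`, and
`e_{k+1} ≤ σ_k e⁰_{k+1}`. -/
def IsComparisonSubtrajectory (graph : Digraph (Fin N))
    (A : Matrix (Fin N × Fin n) (Fin N × Fin n) ℝ) (e : ℕ → Fin N × Fin n → ℝ) : Prop :=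
  (∀ k, 0 ≤ e k) ∧
  ∃ (e0 : ℕ → Fin N × Fin n → ℝ) (σ : ℕ → Matrix (Fin N × Fin n) (Fin N × Fin n) ℝ), ∀ k,
    e0 (k + 1) ≤ A *ᵥ e k ∧ IsMinSelection graph (e0 (k + 1)) (σ k) ∧
    e (k + 1) ≤ σ k *ᵥ e0 (k + 1)

/-- Global exponential stability of a set of trajectories. -/
def GloballyExponentiallyStable {ι : Type*} [Fintype ι] (traj : (ℕ → ι → ℝ) → Prop) : Prop :=
  ∃ c lam : ℝ, 0 < c ∧ 0 < lam ∧ lam < 1 ∧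
    ∀ e, traj e → ∀ k, l2norm (e k) ≤ c * lam ^ k * l2norm (e 0)

/-! ### The distributed observer -/

/-- Bounds on the process noise and on the measurement noises. -/
structure NoiseBounds (agent : Fin N → Agent n p nw) where
  wLo : Fin nw → ℝ
  wHi : Fin nw → ℝ
  vLo : ∀ i, Fin (agent i).nv → ℝ
  vHi : ∀ i, Fin (agent i).nv → ℝ

/-- The vector `(w̄ - w̲, v̄¹ - v̲¹, …, v̄ᴺ - v̲ᴺ)` of all noise interval widths. -/
def NoiseBounds.width {agent : Fin N → Agent n p nw} (nb : NoiseBounds agent) :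
    Fin nw ⊕ ((i : Fin N) × Fin (agent i).nv) → ℝ :=
  Sum.elim (nb.wHi - nb.wLo) fun q => nb.vHi q.1 q.2 - nb.vLo q.1 q.2

/-- A trajectory of the target with arbitrary unknown input `d` and noises within the bounds. -/
structure PlantRun (S : Target n p nw) (agent : Fin N → Agent n p nw)
    (nb : NoiseBounds agent) where
  x : ℕ → Fin n → ℝ
  d : ℕ → Fin p → ℝ
  w : ℕ → Fin nw → ℝ
  v : ∀ i, ℕ → Fin (agent i).nv → ℝ
  x_mem : ∀ k, x k ∈ S.X
  w_mem : ∀ k, w k ∈ Set.Icc nb.wLo nb.wHi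
  v_mem : ∀ i k, v i k ∈ Set.Icc (nb.vLo i) (nb.vHi i)
  dynamics : ∀ k, x (k + 1) = S.f (x k) (w k) + S.G *ᵥ d k

/-- The measurement `y^i_k = C^i x_k + D^i v^i_k + H^i d_k`. -/
def PlantRun.y {S : Target n p nw} {agent : Fin N → Agent n p nw} {nb : NoiseBounds agent}
    (P : PlantRun S agent nb) (i : Fin N) (k : ℕ) : Fin (agent i).l → ℝ :=
  (agent i).C *ᵥ P.x k + (agent i).D *ᵥ P.v i k + (agent i).H *ᵥ P.d k

/-- A run of the four-step distributed observer along a trajectory of the target, from initial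
state framers that are correct. `xLo, xHi, dLo, dHi` are the framers of the agents;
`x0Lo, x0Hi, d0Lo, d0Hi` are the local framers before the network updates. -/
structure ObserverRun (graph : Digraph (Fin N)) {S : Target n p nw}
    {agent : Fin N → Agent n p nw} {nb : NoiseBounds agent} (P : PlantRun S agent nb) where
  xLo : Fin N → ℕ → Fin n → ℝ
  xHi : Fin N → ℕ → Fin n → ℝ
  x0Lo : Fin N → ℕ → Fin n → ℝ
  x0Hi : Fin N → ℕ → Fin n → ℝ
  dLo : Fin N → ℕ → Fin p → ℝ
  dHi : Fin N → ℕ → Fin p → ℝ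
  d0Lo : Fin N → ℕ → Fin p → ℝ
  d0Hi : Fin N → ℕ → Fin p → ℝ
  /-- The initial intervals contain the initial state. -/
  init : ∀ i, P.x 0 ∈ Set.Icc (xLo i 0) (xHi i 0)
  /-- State propagation and measurement update. -/
  step_x0Hi : ∀ i k, x0Hi i (k + 1) =
    boundHi (agent i).Atilde (xHi i k) (xLo i k) +
    boundHi (agent i).T ((agent i).ρd S (xHi i k) nb.wHi (xLo i k) nb.wLo)
      ((agent i).ρd S (xLo i k) nb.wLo (xHi i k) nb.wHi) +
    boundHi ((agent i).Ψ S) ((agent i).ηvec nb.wHi (nb.vHi i))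
      ((agent i).ηvec nb.wLo (nb.vLo i)) +
    (agent i).ζ S (P.y i k) (P.y i (k + 1))
  step_x0Lo : ∀ i k, x0Lo i (k + 1) =
    boundLo (agent i).Atilde (xHi i k) (xLo i k) +
    boundLo (agent i).T ((agent i).ρd S (xHi i k) nb.wHi (xLo i k) nb.wLo)
      ((agent i).ρd S (xLo i k) nb.wLo (xHi i k) nb.wHi) +
    boundLo ((agent i).Ψ S) ((agent i).ηvec nb.wHi (nb.vHi i))
      ((agent i).ηvec nb.wLo (nb.vLo i)) +
    (agent i).ζ S (P.y i k) (P.y i (k + 1))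
  /-- State framer network update: maxima and minima over the neighbours. -/
  step_xLo : ∀ i k s,
    IsGreatest ((fun j => x0Lo j (k + 1) s) '' nbr graph i) (xLo i (k + 1) s)
  step_xHi : ∀ i k s,
    IsLeast ((fun j => x0Hi j (k + 1) s) '' nbr graph i) (xHi i (k + 1) s)
  /-- Input estimation. -/
  step_d0Hi : ∀ i k, d0Hi i k =
    boundHi (agent i).Ah (xHi i k) (xLo i k) +
    (agent i).μd S (xHi i k) nb.wHi (xLo i k) nb.wLo +
    boundHi ((agent i).Λ S) ((agent i).ηvec nb.wHi (nb.vHi i))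
      ((agent i).ηvec nb.wLo (nb.vLo i)) +
    (agent i).ζd S (P.y i k) (P.y i (k + 1))
  step_d0Lo : ∀ i k, d0Lo i k =
    boundLo (agent i).Ah (xHi i k) (xLo i k) +
    (agent i).μd S (xLo i k) nb.wLo (xHi i k) nb.wHi +
    boundLo ((agent i).Λ S) ((agent i).ηvec nb.wHi (nb.vHi i))
      ((agent i).ηvec nb.wLo (nb.vLo i)) +
    (agent i).ζd S (P.y i k) (P.y i (k + 1))
  /-- Input framer network update: maxima and minima over the neighbours. -/
  step_dLo : ∀ i k s, IsGreatest ((fun j => d0Lo j k s) '' nbr graph i) (dLo i k s)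
  step_dHi : ∀ i k s, IsLeast ((fun j => d0Hi j k s) '' nbr graph i) (dHi i k s)

namespace ObserverRun

variable {graph : Digraph (Fin N)} {S : Target n p nw} {agent : Fin N → Agent n p nw}
  {nb : NoiseBounds agent} {P : PlantRun S agent nb}

/-- The collective state framer error `e_{x,k}`. -/
def ex (O : ObserverRun graph P) (k : ℕ) : Fin N × Fin n → ℝ :=
  fun q => O.xHi q.1 k q.2 - O.xLo q.1 k q.2

/-- Up to time `k`, the state framer intervals are contained in the state domain, on which `f` is
defined and its Jacobian is bounded. This always holds if `X = ℝⁿ`. -/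
def InDomain (O : ObserverRun graph P) (k : ℕ) : Prop :=
  ∀ l ≤ k, ∀ i, Set.Icc (O.xLo i l) (O.xHi i l) ⊆ S.X

end ObserverRun

/-- The observer is a distributed resilient interval framer: its state and input framers are
correct for all initial data, all noises within the bounds and every unknown input sequence. -/
def IsResilientFramer (graph : Digraph (Fin N)) (S : Target n p nw)
    (agent : Fin N → Agent n p nw) : Prop :=
  ∀ (nb : NoiseBounds agent), Set.Icc nb.wLo nb.wHi ⊆ S.W →
    ∀ (P : PlantRun S agent nb) (O : ObserverRun graph P) (k : ℕ), O.InDomain k →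
      ∀ i, P.x k ∈ Set.Icc (O.xLo i k) (O.xHi i k) ∧ P.d k ∈ Set.Icc (O.dLo i k) (O.dHi i k)

/-- The observer is a C-ISS distributed resilient interval observer: it is a distributed resilient
interval framer, and its collective state framer error is input-to-state stable with respect to the
noise interval widths. The gains `β` and `γ` do not depend on the noise bounds, the noises, the
unknown input or the initial data. -/
def IsCISSObserver (graph : Digraph (Fin N)) (S : Target n p nw)
    (agent : Fin N → Agent n p nw) : Prop :=
  IsResilientFramer graph S agent ∧
  ∃ (β : ℝ → ℝ → ℝ) (γ : ℝ → ℝ), ClassKL β ∧ ClassKInf γ ∧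
    ∀ (nb : NoiseBounds agent), Set.Icc nb.wLo nb.wHi ⊆ S.W →
      ∀ (P : PlantRun S agent nb) (O : ObserverRun graph P) (k : ℕ), O.InDomain k →
        l2norm (O.ex k) ≤ β (l2norm (O.ex 0)) k + γ (l2norm nb.width)

end Network

end ResilientObserver

end

noncomputable section

namespace ResilientObserver

/-! ### Nonnegative matrices -/

section Nonneg

variable {ι κ : Type*} [Fintype ι]

/-! The argument rests on one characterization: a nonnegative matrix `M` is Schur stable exactly
when some positive vector `v` satisfies `M v ≤ μ v` with `μ < 1` (`schurStable_of_subinvariant`,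
`SchurStable.exists_subinvariant`). Such a `v` yields exponential bounds by monotone induction, also
under constant disturbances (`le_of_subinvariant`).

If `σ_* 𝒜` is Schur stable, the minimizing selection produces at every step a vector below the one
produced by `σ_*`. Every comparison trajectory therefore satisfies the fixed linear inequality
`e_{k+1} ≤ σ_* 𝒜 e_k`, and `v` bounds it geometrically.

For the converse (`exists_schurStable_of_stable`), the comparison system is the iteration of the
monotone, homogeneous map `e ↦ min(𝒜 e)`, the minimum being taken over neighbours. Stability makes
the orbit of the vector of ones fall below `μ^K` at some time `K`. A small constant disturbance `ε`
keeps this bound and makes the orbit `g_j` positive. The pointwise minimum `v` of `μ^{-j} g_j` over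
`j < K` then satisfies `min(𝒜 v) ≤ μ v`: each term is mapped below `μ` times its successor, and the
last below `μ` times the first. The selection that is minimal at the single vector `𝒜 v` turns this
into `σ 𝒜 v ≤ μ v`.

For the observer, full column rank allows the unknown input to be eliminated exactly
(`Agent.state_identity`, `Agent.input_identity`). Interval bounds and the mean value theorem frame
each remaining term, and intersecting correct intervals keeps them correct. The width of the
intersection is at most that of any one neighbour, so the true error obeys the same linear
inequality for `σ_*`, up to a noise term (`ObserverRun.ex_succ_le`). -/

lemma mulVec_mono_of_nonneg {M : Matrix κ ι ℝ} (hM : ∀ a b, 0 ≤ M a b) {u v : ι → ℝ}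
    (h : u ≤ v) : M *ᵥ u ≤ M *ᵥ v := fun a =>
  Finset.sum_le_sum fun b _ => mul_le_mul_of_nonneg_left (h b) (hM a b)

lemma mulVec_le_mulVec_of_le {M M' : Matrix κ ι ℝ} (hM : ∀ a b, M a b ≤ M' a b) {u : ι → ℝ}
    (h : 0 ≤ u) : M *ᵥ u ≤ M' *ᵥ u := fun a =>
  Finset.sum_le_sum fun b _ => mul_le_mul_of_nonneg_right (hM a b) (h b)

lemma mulVec_nonneg_of_nonneg {M : Matrix κ ι ℝ} (hM : ∀ a b, 0 ≤ M a b) {u : ι → ℝ}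
    (h : 0 ≤ u) : 0 ≤ M *ᵥ u := fun a =>
  Finset.sum_nonneg fun b _ => mul_nonneg (hM a b) (h b)

lemma abs_le_l2norm (v : ι → ℝ) (a : ι) : |v a| ≤ l2norm v :=
  PiLp.norm_apply_le (p := 2) (WithLp.toLp 2 v : EuclideanSpace ℝ ι) a

lemma l2norm_nonneg (v : ι → ℝ) : 0 ≤ l2norm v := norm_nonneg _

lemma l2norm_mono {u v : ι → ℝ} (h0 : 0 ≤ u) (h : u ≤ v) : l2norm u ≤ l2norm v := by
  unfold l2norm
  rw [EuclideanSpace.norm_eq, EuclideanSpace.norm_eq]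
  refine Real.sqrt_le_sqrt (Finset.sum_le_sum fun a _ => ?_)
  have h1 : (0 : ℝ) ≤ u a := h0 a
  have h2 : u a ≤ v a := h a
  simp only [Real.norm_eq_abs, sq_abs]
  gcongr

lemma l2norm_smul {t : ℝ} (ht : 0 ≤ t) (v : ι → ℝ) : l2norm (t • v) = t * l2norm v := by
  unfold l2norm
  rw [WithLp.toLp_smul, norm_smul, Real.norm_of_nonneg ht]

/-- Perturbed linear comparison inequalities in the norm weighted by a subinvariant vector. -/
lemma le_of_subinvariant {M : Matrix ι ι ℝ} (hM : ∀ a b, 0 ≤ M a b) {v : ι → ℝ}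
    {μ r δ : ℝ} (hv : 0 ≤ v) (hμ0 : 0 < μ) (hμ : μ < 1) (h : M *ᵥ v ≤ μ • v) (hr : 0 ≤ r)
    (hδ : 0 ≤ δ) {e : ℕ → ι → ℝ} {k : ℕ} (he : ∀ l < k, e (l + 1) ≤ M *ᵥ e l + δ • v)
    (h0 : e 0 ≤ r • v) : e k ≤ (μ ^ k * r + δ / (1 - μ)) • v := by
  have hμ' : 0 < 1 - μ := by linarith
  induction k with
  | zero =>
    refine h0.trans (smul_le_smul_of_nonneg_right ?_ hv)
    have : 0 ≤ δ / (1 - μ) := by positivity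
    simpa using this
  | succ k ih =>
    have ih' := ih fun l hl => he l (by omega)
    refine (he k (by omega)).trans ?_
    have h1 : M *ᵥ e k ≤ (μ ^ k * r + δ / (1 - μ)) • (μ • v) := by
      refine (mulVec_mono_of_nonneg hM ih').trans ?_
      rw [mulVec_smul]
      exact smul_le_smul_of_nonneg_left h (by positivity)
    intro a
    have h2 := h1 a
    simp only [Pi.add_apply, Pi.smul_apply, smul_eq_mul] at h2 ⊢
    -- The offset `δ / (1 - μ)` is the fixed point of `t ↦ μ t + δ`, so the bound reproduces itself.
    have : (μ ^ (k + 1) * r + δ / (1 - μ)) * v a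
        = (μ ^ k * r + δ / (1 - μ)) * (μ * v a) + δ * v a := by
      field_simp
      ring
    linarith

/-! ### Schur stability and strict subinvariant vectors -/

variable [DecidableEq ι]

/-- A nonnegative matrix with a positive strict subinvariant vector is Schur stable. -/
lemma schurStable_of_subinvariant {M : Matrix ι ι ℝ} (hM : ∀ a b, 0 ≤ M a b) {v : ι → ℝ}
    (hv : ∀ a, 0 < v a) {μ : ℝ} (hμ : μ < 1) (h : M *ᵥ v ≤ μ • v) : SchurStable M := by
  intro z hz
  rw [← Matrix.spectrum_toLin', ← Module.End.hasEigenvalue_iff_mem_spectrum] at hz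
  obtain ⟨y, hy⟩ := hz.exists_hasEigenvector
  have hy0 : y ≠ 0 := hy.2
  have hMy : (M.map Complex.ofReal) *ᵥ y = z • y := by
    simpa using hy.apply_eq_smul
  obtain ⟨b0, hb0⟩ := Function.ne_iff.1 hy0
  -- The eigenvalue equation is read at a coordinate where the eigenvector attains its maximum norm
  -- weighted by `v`; there the row estimate gives `‖z‖ ≤ μ`.
  obtain ⟨a, -, ha⟩ := Finset.exists_max_image Finset.univ (fun b => ‖y b‖ / v b) ⟨b0, Finset.mem_univ _⟩
  set t := ‖y a‖ / v a with ht
  have htpos : 0 < t := lt_of_lt_of_le (div_pos (norm_pos_iff.2 hb0) (hv b0)) (ha b0 (Finset.mem_univ _))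
  have hle : ∀ b, ‖y b‖ ≤ t * v b := fun b =>
    (div_le_iff₀ (hv b)).1 (ha b (Finset.mem_univ _))
  have hya : ‖y a‖ = t * v a := by rw [ht, div_mul_cancel₀ _ (hv a).ne']
  have key : ‖z‖ * (t * v a) ≤ μ * (t * v a) := by
    calc ‖z‖ * (t * v a) = ‖((M.map Complex.ofReal) *ᵥ y) a‖ := by
          rw [hMy, Pi.smul_apply, smul_eq_mul, norm_mul, hya]
      _ ≤ ∑ b, M a b * ‖y b‖ := by
          refine (norm_sum_le _ _).trans (Finset.sum_le_sum fun b _ => ?_)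
          simp [abs_of_nonneg (hM a b)]
      _ ≤ ∑ b, M a b * (t * v b) :=
          Finset.sum_le_sum fun b _ => mul_le_mul_of_nonneg_left (hle b) (hM a b)
      _ = t * (M *ᵥ v) a := by
          simp only [mulVec, dotProduct, Finset.mul_sum]
          exact Finset.sum_congr rfl fun b _ => by ring
      _ ≤ t * (μ * v a) := mul_le_mul_of_nonneg_left (h a) htpos.le
      _ = μ * (t * v a) := by ring
  exact (le_of_mul_le_mul_right key (mul_pos htpos (hv a))).trans_lt hμ

section Gelfand

attribute [local instance] Matrix.linftyOpNormedRing Matrix.linftyOpNormedAlgebra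

/-- The powers of a Schur stable matrix are eventually dominated by a geometric sequence. -/
lemma SchurStable.exists_pow_mulVec_one_le [Nonempty ι] {M : Matrix ι ι ℝ} (hS : SchurStable M) :
    ∃ (μ : ℝ) (K : ℕ), 0 < μ ∧ μ < 1 ∧ 0 < K ∧ ∀ a, ((M ^ K) *ᵥ 1) a ≤ μ ^ K := by
  set Mc : Matrix ι ι ℂ := M.map Complex.ofReal with hMc
  have hlt : spectralRadius ℂ Mc < (1 : NNReal) :=
    spectrum.spectralRadius_lt_of_forall_lt Mc fun z hz => by exact_mod_cast hS z hz
  obtain ⟨μ, hμ1, hμ2⟩ := ENNReal.lt_iff_exists_nnreal_btwn.1 hlt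
  have hμpos : 0 < μ := by
    have := lt_of_le_of_lt zero_le hμ1
    exact_mod_cast this
  -- Gelfand's formula, in the operator norm induced by the sup norm, which suits the row sums `M ^
  -- K *ᵥ 1`.
  have hev := (spectrum.pow_nnnorm_pow_one_div_tendsto_nhds_spectralRadius Mc).eventually_lt_const hμ1
  obtain ⟨K, hK, hK0⟩ := (hev.and (Filter.eventually_gt_atTop 0)).exists
  have hnorm : ‖Mc ^ K‖ ≤ (μ : ℝ) ^ K := by
    have h1 : (‖Mc ^ K‖₊ : ENNReal) ≤ (μ : ENNReal) ^ K := by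
      have h2 := ENNReal.rpow_le_rpow hK.le (Nat.cast_nonneg K : (0 : ℝ) ≤ K)
      rwa [← ENNReal.rpow_mul, one_div, inv_mul_cancel₀ (by positivity), ENNReal.rpow_one,
        ENNReal.rpow_natCast] at h2
    exact_mod_cast h1
  refine ⟨μ, K, by exact_mod_cast hμpos, by exact_mod_cast hμ2, hK0, fun a => ?_⟩
  have hmap : ((M ^ K) *ᵥ 1) a = (((Mc ^ K) *ᵥ 1) a).re := by
    have : Mc ^ K = (M ^ K).map Complex.ofReal := by
      rw [hMc]; exact (Matrix.map_pow M Complex.ofRealHom K).symm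
    rw [this]
    simp [mulVec, dotProduct]
  rw [hmap]
  calc (((Mc ^ K) *ᵥ 1) a).re ≤ ‖((Mc ^ K) *ᵥ 1) a‖ := Complex.re_le_norm _
    _ ≤ ‖(Mc ^ K) *ᵥ 1‖ := norm_le_pi_norm _ _
    _ ≤ ‖Mc ^ K‖ * ‖(1 : ι → ℂ)‖ := linfty_opNorm_mulVec _ _
    _ = ‖Mc ^ K‖ := by simp
    _ ≤ μ ^ K := hnorm

end Gelfand

/-- A nonnegative Schur stable matrix has a positive strict subinvariant vector. -/
lemma SchurStable.exists_subinvariant {M : Matrix ι ι ℝ} (hM : ∀ a b, 0 ≤ M a b)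
    (hS : SchurStable M) :
    ∃ (v : ι → ℝ) (μ : ℝ), (∀ a, 1 ≤ v a) ∧ 0 < μ ∧ μ < 1 ∧ M *ᵥ v ≤ μ • v := by
  rcases isEmpty_or_nonempty ι with _ | _
  · exact ⟨1, 1 / 2, fun _ => le_rfl, by norm_num, by norm_num, fun a => isEmptyElim a⟩
  obtain ⟨μ, K, hμ0, hμ1, hK0, hK⟩ := hS.exists_pow_mulVec_one_le
  have hpow : ∀ j, 0 ≤ (M ^ j) *ᵥ (1 : ι → ℝ) := by
    intro j
    induction j with
    | zero => simp
    | succ j ih =>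
      rw [pow_succ', ← mulVec_mulVec]
      exact mulVec_nonneg_of_nonneg hM ih
  set u : ℕ → ι → ℝ := fun j => (μ ^ j)⁻¹ • ((M ^ j) *ᵥ (1 : ι → ℝ)) with hu
  have hu0 : ∀ j, 0 ≤ u j := fun j => smul_nonneg (by positivity) (hpow j)
  have hstep : ∀ j, M *ᵥ u j = μ • u (j + 1) := by
    intro j
    simp only [hu]
    rw [mulVec_smul, mulVec_mulVec, ← pow_succ', smul_smul, pow_succ μ, mul_inv,
      mul_left_comm, mul_inv_cancel₀ hμ0.ne', mul_one]
  have hu_zero : u 0 = 1 := by simp [hu]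
  have huK : u K ≤ u 0 := by
    intro a
    rw [hu_zero]
    simp only [hu, Pi.smul_apply, smul_eq_mul, Pi.one_apply]
    rw [inv_mul_le_iff₀ (by positivity), mul_one]
    exact hK a
  -- With `u j = μ^{-j} M^j 1`, applying `M` to the sum shifts it by one index and gains a factor
  -- `μ`. The shifted sum replaces `u 0` by `u K ≤ u 0`, and the term `u 0 = 1` makes every
  -- coordinate at least `1`.
  refine ⟨∑ j ∈ Finset.range K, u j, μ, fun a => ?_, hμ0, hμ1, ?_⟩
  · rw [Finset.sum_apply]
    have := Finset.single_le_sum (f := fun j => u j a) (fun j _ => hu0 j a) (Finset.mem_range.2 hK0)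
    simpa [hu_zero] using this
  · rw [mulVec_sum, Finset.smul_sum]
    simp only [hstep]
    rw [← Finset.smul_sum, ← Finset.smul_sum]
    refine smul_le_smul_of_nonneg_left ?_ hμ0.le
    have h1 := Finset.sum_range_succ u K
    have h2 := Finset.sum_range_succ' u K
    rw [h1] at h2
    have : ∑ j ∈ Finset.range K, u (j + 1) = ∑ j ∈ Finset.range K, u j + u K - u 0 := by
      rw [h2]; abel
    rw [this, add_sub_assoc]
    intro a
    have := huK a
    simp only [Pi.add_apply, Pi.sub_apply]
    linarith

end Nonneg

/-! ### Network selections -/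

section Selection

variable {N n : ℕ} {graph : Digraph (Fin N)}

/-- The selection matrix whose row `(i, s)` has its `1` in column `(φ (i, s), s)`. -/
def selMatrix (φ : Fin N × Fin n → Fin N) : Matrix (Fin N × Fin n) (Fin N × Fin n) ℝ :=
  Matrix.of fun a b => if b = (φ a, a.2) then 1 else 0

lemma selMatrix_mulVec (φ : Fin N × Fin n → Fin N) (u : Fin N × Fin n → ℝ) (a : Fin N × Fin n) :
    (selMatrix φ *ᵥ u) a = u (φ a, a.2) := by
  simp [selMatrix, mulVec, dotProduct]

lemma selMatrix_mem {φ : Fin N × Fin n → Fin N} (hφ : ∀ a, φ a ∈ nbr graph a.1) :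
    selMatrix φ ∈ SigmaX n graph := by
  refine ⟨fun a b => ?_, fun a b h => ?_, fun a => ?_⟩
  · simp only [selMatrix, of_apply]
    split_ifs <;> simp
  · simp only [selMatrix, of_apply]
    rw [if_neg]
    rintro rfl
    exact h ⟨hφ a, rfl⟩
  · simp [selMatrix]

/-- Binary entries with row sum one leave a single nonzero entry per row, so admissible matrices are
the same as neighbour-valued functions of the coordinates. -/
lemma exists_eq_selMatrix {σ : Matrix (Fin N × Fin n) (Fin N × Fin n) ℝ}
    (hσ : σ ∈ SigmaX n graph) :
    ∃ φ : Fin N × Fin n → Fin N, (∀ a, φ a ∈ nbr graph a.1) ∧ σ = selMatrix φ := by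
  obtain ⟨h01, hzero, hsum⟩ := hσ
  have hex : ∀ a, ∃ j, j ∈ nbr graph a.1 ∧ ∀ b, σ a b = if b = (j, a.2) then 1 else 0 := by
    intro a
    obtain ⟨b, hb⟩ : ∃ b, σ a b ≠ 0 := by
      by_contra! hcon
      have := hsum a
      simp [hcon] at this
    have hb1 : σ a b = 1 := (h01 a b).resolve_left hb
    have hbn : b.1 ∈ nbr graph a.1 ∧ b.2 = a.2 := by
      by_contra hcon
      exact hb (hzero a b hcon)
    refine ⟨b.1, hbn.1, fun b' => ?_⟩
    rw [← hbn.2]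
    split_ifs with h
    · rw [h]; exact hb1
    · have hs := hsum a
      rw [← Finset.add_sum_erase _ _ (Finset.mem_univ b), hb1] at hs
      have hs' : ∑ x ∈ Finset.univ.erase b, σ a x = 0 := by linarith
      rw [Finset.sum_eq_zero_iff_of_nonneg] at hs'
      · exact hs' b' (Finset.mem_erase.2 ⟨h, Finset.mem_univ _⟩)
      · intro x _
        rcases h01 a x with hx | hx <;> simp [hx]
  choose φ hφ1 hφ2 using hex
  exact ⟨φ, hφ1, by ext a b; simp [selMatrix, hφ2]⟩

lemma SigmaX_nonneg {σ : Matrix (Fin N × Fin n) (Fin N × Fin n) ℝ} (hσ : σ ∈ SigmaX n graph)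
    (a b : Fin N × Fin n) : 0 ≤ σ a b := by
  rcases hσ.1 a b with h | h <;> simp [h]

lemma SigmaX_mul_nonneg {σ A : Matrix (Fin N × Fin n) (Fin N × Fin n) ℝ}
    (hσ : σ ∈ SigmaX n graph) (hA : ∀ a b, 0 ≤ A a b) (a b : Fin N × Fin n) :
    0 ≤ (σ * A) a b :=
  Finset.sum_nonneg fun c _ => mul_nonneg (SigmaX_nonneg hσ a c) (hA c b)

lemma IsMinSelection.exists_eq {u : Fin N × Fin n → ℝ}
    {σ : Matrix (Fin N × Fin n) (Fin N × Fin n) ℝ} (h : IsMinSelection graph u σ)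
    (a : Fin N × Fin n) :
    ∃ j ∈ nbr graph a.1, (σ *ᵥ u) a = u (j, a.2) ∧
      ∀ j' ∈ nbr graph a.1, u (j, a.2) ≤ u (j', a.2) := by
  obtain ⟨φ, hφ, rfl⟩ := exists_eq_selMatrix h.1
  refine ⟨φ a, hφ a, selMatrix_mulVec φ u a, ?_⟩
  have := (h.2 a.1 (φ a) a.2).1 (by simp [selMatrix])
  exact this.1.2

/-- This optimality lets one fixed stabilizing selection dominate every step of the switched system.
-/
lemma IsMinSelection.mulVec_le {u : Fin N × Fin n → ℝ}
    {σ σ' : Matrix (Fin N × Fin n) (Fin N × Fin n) ℝ} (h : IsMinSelection graph u σ)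
    (hσ' : σ' ∈ SigmaX n graph) : σ *ᵥ u ≤ σ' *ᵥ u := by
  intro a
  obtain ⟨φ, hφ, rfl⟩ := exists_eq_selMatrix hσ'
  obtain ⟨j, -, h1, h2⟩ := h.exists_eq a
  rw [h1, selMatrix_mulVec]
  exact h2 _ (hφ a)

/-- Neighbourhoods are finite and nonempty, so each argmin set is nonempty and has a least index. -/
lemma exists_isMinSelection (hnbr : ∀ i, (nbr graph i).Nonempty) (u : Fin N × Fin n → ℝ) :
    ∃ σ, IsMinSelection graph u σ := by
  classical
  have hex : ∀ a : Fin N × Fin n, ∃ j, IsLeast {j' | j' ∈ nbr graph a.1 ∧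
      ∀ j'' ∈ nbr graph a.1, u (j', a.2) ≤ u (j'', a.2)} j := by
    intro a
    obtain ⟨j, hj, hmin⟩ := (Set.toFinite (nbr graph a.1)).exists_minimalFor
      (fun j => u (j, a.2)) _ (hnbr a.1)
    have hne : {j' | j' ∈ nbr graph a.1 ∧
        ∀ j'' ∈ nbr graph a.1, u (j', a.2) ≤ u (j'', a.2)}.Nonempty :=
      ⟨j, hj, fun j'' hj'' => (le_total _ _).elim id fun h => hmin hj'' h⟩
    exact (Set.toFinite _).exists_minimal hne |>.imp fun x hx =>
      ⟨hx.1, fun y hy => (le_total x y).elim id fun h => hx.2 hy h⟩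
  choose φ hφ using hex
  refine ⟨selMatrix φ, selMatrix_mem fun a => (hφ a).1.1, fun i j s => ?_⟩
  constructor
  · intro h
    have : j = φ (i, s) := by
      by_contra hne
      simp [selMatrix, hne] at h
    rw [this]; exact hφ (i, s)
  · intro h
    have : j = φ (i, s) := h.unique (hφ (i, s))
    simp [selMatrix, this]

/-! ### The minimum map over neighbourhoods -/

/-- Componentwise minimum over the neighbours. -/
def netMin (hnbr : ∀ i, (nbr graph i).Nonempty) (u : Fin N × Fin n → ℝ) : Fin N × Fin n → ℝ :=
  fun a => (Set.toFinite (nbr graph a.1)).toFinset.inf' (by simpa using hnbr a.1)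
    fun j => u (j, a.2)

variable (hnbr : ∀ i, (nbr graph i).Nonempty)

lemma continuous_netMin : Continuous (netMin (n := n) hnbr) :=
  continuous_pi fun _ => Continuous.finset_inf'_apply _ fun _ _ => continuous_apply _

lemma netMin_nonneg {u : Fin N × Fin n → ℝ} (hu : 0 ≤ u) : 0 ≤ netMin hnbr u :=
  fun a => Finset.le_inf' _ _ fun j _ => hu (j, a.2)

lemma netMin_mono {u v : Fin N × Fin n → ℝ} (h : u ≤ v) : netMin hnbr u ≤ netMin hnbr v :=
  fun _ => Finset.le_inf' _ _ fun _ hj => (Finset.inf'_le _ hj).trans (h _)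

/-- Evaluating at a minimizer of `u` gives this inequality for every sign of `t`; equality is not
needed below. -/
lemma netMin_smul_le (t : ℝ) (u : Fin N × Fin n → ℝ) :
    netMin hnbr (t • u) ≤ t • netMin hnbr u := by
  intro a
  obtain ⟨j, hj, h⟩ := Finset.exists_mem_eq_inf' (s := (Set.toFinite (nbr graph a.1)).toFinset)
    (by simpa using hnbr a.1) (fun j => u (j, a.2))
  have : (t • netMin hnbr u) a = t * u (j, a.2) := by
    rw [Pi.smul_apply, smul_eq_mul, netMin, h]
  rw [this]
  exact Finset.inf'_le _ hj

/-- The tie-breaking rule does not affect the selected value, so the switched update is a single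
continuous monotone map. -/
lemma IsMinSelection.mulVec_eq_netMin {u : Fin N × Fin n → ℝ}
    {σ : Matrix (Fin N × Fin n) (Fin N × Fin n) ℝ} (h : IsMinSelection graph u σ) :
    σ *ᵥ u = netMin hnbr u := by
  ext a
  obtain ⟨j, hj, h1, h2⟩ := h.exists_eq a
  rw [h1]
  refine le_antisymm (Finset.le_inf' _ _ fun j' hj' => h2 j' (by simpa using hj')) ?_
  exact Finset.inf'_le (fun j => u (j, a.2)) (by simpa using hj)

/-! ### Stability of the comparison systems -/

variable {A : Matrix (Fin N × Fin n) (Fin N × Fin n) ℝ}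

/-- The comparison system started at the vector of ones, with a constant disturbance `ε`. -/
def perturbedOrbit (A : Matrix (Fin N × Fin n) (Fin N × Fin n) ℝ) (ε : ℝ) :
    ℕ → Fin N × Fin n → ℝ
  | 0 => 1
  | k + 1 => netMin hnbr (A *ᵥ perturbedOrbit A ε k) + fun _ => ε

/-- Used at a fixed time, to carry a strict bound from `ε = 0` to some `ε > 0`. -/
lemma continuous_perturbedOrbit (k : ℕ) : Continuous fun ε => perturbedOrbit hnbr A ε k := by
  induction k with
  | zero => exact continuous_const
  | succ k ih =>
    refine Continuous.add ?_ (continuous_pi fun _ => continuous_id)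
    exact (continuous_netMin hnbr).comp (Continuous.matrix_mulVec continuous_const ih)

lemma perturbedOrbit_nonneg (hA : ∀ a b, 0 ≤ A a b) {ε : ℝ} (hε : 0 ≤ ε) (k : ℕ) :
    0 ≤ perturbedOrbit hnbr A ε k := by
  induction k with
  | zero => exact fun _ => zero_le_one
  | succ k ih =>
    exact add_nonneg (netMin_nonneg hnbr (mulVec_nonneg_of_nonneg hA ih)) fun _ => hε

/-- This is the reason for the disturbance: the undisturbed orbit may reach zero in some coordinate,
whereas the criterion for Schur stability needs a positive vector. -/
lemma perturbedOrbit_pos (hA : ∀ a b, 0 ≤ A a b) {ε : ℝ} (hε : 0 < ε) (k : ℕ)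
    (a : Fin N × Fin n) : 0 < perturbedOrbit hnbr A ε k a := by
  cases k with
  | zero => exact zero_lt_one
  | succ k =>
    exact add_pos_of_nonneg_of_pos (netMin_nonneg hnbr
      (mulVec_nonneg_of_nonneg hA (perturbedOrbit_nonneg hnbr hA hε.le k)) a) hε

lemma isComparisonTrajectory_perturbedOrbit (hA : ∀ a b, 0 ≤ A a b) :
    IsComparisonTrajectory graph A (perturbedOrbit hnbr A 0) := by
  refine ⟨perturbedOrbit_nonneg hnbr hA le_rfl, ?_⟩
  choose σ hσ using fun k => exists_isMinSelection hnbr (A *ᵥ perturbedOrbit hnbr A 0 k)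
  refine ⟨σ, fun k => ⟨hσ k, ?_⟩⟩
  rw [← mulVec_mulVec, (hσ k).mulVec_eq_netMin hnbr]
  exact add_zero _

lemma IsComparisonTrajectory.subtrajectory {e : ℕ → Fin N × Fin n → ℝ}
    (h : IsComparisonTrajectory graph A e) : IsComparisonSubtrajectory graph A e := by
  obtain ⟨h0, σ, hσ⟩ := h
  -- Only the values at `k + 1` are constrained, where the index shift gives `A *ᵥ e k`; the value
  -- at `0` is a dummy.
  refine ⟨h0, fun k => A *ᵥ e (k - 1), σ, fun k => ⟨le_rfl, (hσ k).1, ?_⟩⟩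
  rw [(hσ k).2, ← mulVec_mulVec]
  exact le_rfl

include hnbr in
/-- Global exponential stability of the comparison system provides a stabilizing selection. -/
lemma exists_schurStable_of_stable (hA : ∀ a b, 0 ≤ A a b)
    (h : GloballyExponentiallyStable (IsComparisonTrajectory graph A)) :
    ∃ σ ∈ SigmaX n graph, SchurStable (σ * A) := by
  obtain ⟨c, lam, hc, hlam0, hlam1, htraj⟩ := h
  have hdecay := htraj _ (isComparisonTrajectory_perturbedOrbit hnbr hA)
  -- The gap between `lam` and `μ` absorbs the constant `C` after finitely many steps.
  obtain ⟨μ, hμl, hμ1⟩ := exists_between hlam1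
  have hμ0 : 0 < μ := hlam0.trans hμl
  set C := c * l2norm (perturbedOrbit hnbr A 0 0) with hC
  obtain ⟨K, hK, hK0⟩ : ∃ K : ℕ, C * (lam / μ) ^ K < 1 ∧ 0 < K := by
    have ht := (tendsto_pow_atTop_nhds_zero_of_lt_one (by positivity : 0 ≤ lam / μ)
      ((div_lt_one hμ0).2 hμl)).const_mul C
    rw [mul_zero] at ht
    exact ((ht.eventually_lt_const one_pos).and (Filter.eventually_gt_atTop 0)).exists
  have hK' : ∀ a, perturbedOrbit hnbr A 0 K a < μ ^ K := by
    intro a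
    calc perturbedOrbit hnbr A 0 K a ≤ l2norm (perturbedOrbit hnbr A 0 K) :=
          (le_abs_self _).trans (abs_le_l2norm _ a)
      _ ≤ C * lam ^ K := by rw [hC]; linarith [hdecay K]
      _ = C * (lam / μ) ^ K * μ ^ K := by
          rw [div_pow]; field_simp
      _ < μ ^ K := by
          have := mul_lt_mul_of_pos_right hK (pow_pos hμ0 K)
          rwa [one_mul] at this
  have hev : ∀ᶠ ε in nhds (0 : ℝ), ∀ a, perturbedOrbit hnbr A ε K a < μ ^ K := by
    rw [Filter.eventually_all]
    intro a
    exact ((continuous_apply a).comp (continuous_perturbedOrbit hnbr K)).continuousAt.eventually_lt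
      continuousAt_const (hK' a)
  obtain ⟨ε, hεK, hε⟩ := ((hev.filter_mono nhdsWithin_le_nhds).and
    (self_mem_nhdsWithin : Set.Ioi (0 : ℝ) ∈ nhdsWithin 0 (Set.Ioi 0))).exists
  have hε : 0 < ε := hε
  set g := perturbedOrbit hnbr A ε with hg
  have hne : (Finset.range K).Nonempty := ⟨0, Finset.mem_range.2 hK0⟩
  -- A minimum is used, rather than a sum as in the linear case, because the update is monotone and
  -- homogeneous but not additive.
  set v : Fin N × Fin n → ℝ := fun a => (Finset.range K).inf' hne fun j => (μ ^ j)⁻¹ * g j a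
    with hv
  have hvpos : ∀ a, 0 < v a := fun a => (Finset.lt_inf'_iff _).2 fun j _ =>
    mul_pos (by positivity) (perturbedOrbit_pos hnbr hA hε j a)
  have hvle : ∀ j < K, v ≤ (μ ^ j)⁻¹ • g j := fun j hj a =>
    Finset.inf'_le (fun j => (μ ^ j)⁻¹ * g j a) (Finset.mem_range.2 hj)
  have hstep : ∀ j < K, netMin hnbr (A *ᵥ v) ≤ (μ ^ j)⁻¹ • g (j + 1) := by
    intro j hj
    have hpos : 0 ≤ (μ ^ j)⁻¹ := by positivity
    calc netMin hnbr (A *ᵥ v) ≤ netMin hnbr ((μ ^ j)⁻¹ • (A *ᵥ g j)) := by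
          rw [← mulVec_smul]
          exact netMin_mono hnbr (mulVec_mono_of_nonneg hA (hvle j hj))
      _ ≤ (μ ^ j)⁻¹ • netMin hnbr (A *ᵥ g j) := netMin_smul_le hnbr _ _
      _ ≤ (μ ^ j)⁻¹ • g (j + 1) :=
          smul_le_smul_of_nonneg_left (fun a => le_add_of_nonneg_right hε.le) hpos
  obtain ⟨σ, hσ⟩ := exists_isMinSelection hnbr (A *ᵥ v)
  refine ⟨σ, hσ.1, schurStable_of_subinvariant (SigmaX_mul_nonneg hσ.1 hA) hvpos hμ1 ?_⟩
  rw [← mulVec_mulVec, hσ.mulVec_eq_netMin hnbr]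
  intro a
  rw [Pi.smul_apply, smul_eq_mul, ← inv_mul_le_iff₀ hμ0]
  refine Finset.le_inf' _ _ fun j hj => ?_
  rw [inv_mul_le_iff₀ hμ0]
  cases j with
  | zero =>
    -- The term `j = 0` has no predecessor in the cycle; it is reached from the last index `K - 1`
    -- through `g K ≤ μ ^ K`.
    obtain ⟨K', rfl⟩ : ∃ K', K = K' + 1 := ⟨K - 1, by omega⟩
    refine (hstep K' (by omega) a).trans ?_
    have h1 : g (K' + 1) a ≤ μ ^ (K' + 1) := (hεK a).le
    have h2 : g 0 a = 1 := rfl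
    rw [Pi.smul_apply, smul_eq_mul, h2, inv_mul_le_iff₀ (by positivity)]
    calc g (K' + 1) a ≤ μ ^ (K' + 1) := h1
      _ = μ ^ K' * (μ * ((μ ^ 0)⁻¹ * 1)) := by rw [pow_succ]; simp
  | succ j =>
    have hj' := Finset.mem_range.1 hj
    refine (hstep j (by omega) a).trans (le_of_eq ?_)
    rw [Pi.smul_apply, smul_eq_mul]
    field_simp
    ring

/-- A stabilizing selection makes the comparison inequality globally exponentially stable. -/
lemma subtrajectory_stable_of_schurStable (hA : ∀ a b, 0 ≤ A a b)
    (h : ∃ σ ∈ SigmaX n graph, SchurStable (σ * A)) :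
    GloballyExponentiallyStable (IsComparisonSubtrajectory graph A) := by
  obtain ⟨σ, hσ, hS⟩ := h
  have hM := SigmaX_mul_nonneg hσ hA
  obtain ⟨v, μ, hv, hμ0, hμ1, hsub⟩ := hS.exists_subinvariant hM
  have hv0 : 0 ≤ v := fun a => zero_le_one.trans (hv a)
  -- The `+ 1` keeps the constant positive even when there are no coordinates.
  refine ⟨l2norm v + 1, μ, by linarith [l2norm_nonneg v], hμ0, hμ1, ?_⟩
  rintro e ⟨he, e0, τ, hτ⟩ k
  have hr := l2norm_nonneg (e 0)
  have hk : e k ≤ (μ ^ k * l2norm (e 0)) • v := by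
    have := le_of_subinvariant (k := k) (e := e) hM hv0 hμ0 hμ1 hsub hr le_rfl ?_ ?_
    · simpa using this
    · intro l _
      rw [zero_smul, add_zero, ← mulVec_mulVec]
      obtain ⟨h1, h2, h3⟩ := hτ l
      exact h3.trans ((h2.mulVec_le hσ).trans (mulVec_mono_of_nonneg (SigmaX_nonneg hσ) h1))
    · intro a
      calc e 0 a ≤ l2norm (e 0) * 1 := by
            rw [mul_one]; exact (le_abs_self _).trans (abs_le_l2norm _ a)
        _ ≤ l2norm (e 0) * v a := mul_le_mul_of_nonneg_left (hv a) hr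
  have hp : 0 ≤ μ ^ k * l2norm (e 0) := by positivity
  calc l2norm (e k) ≤ μ ^ k * l2norm (e 0) * l2norm v := by
        rw [← l2norm_smul hp]; exact l2norm_mono (he k) hk
    _ ≤ (l2norm v + 1) * μ ^ k * l2norm (e 0) := by nlinarith

include hnbr in
-- The three properties form a cycle: the inequality form contains all exact trajectories, exact
-- stability yields a selection, and a selection stabilizes the inequality form.
theorem stable_iff_exists_schurStable (hA : ∀ a b, 0 ≤ A a b) :
    (GloballyExponentiallyStable (IsComparisonTrajectory graph A) ↔
      ∃ σ ∈ SigmaX n graph, SchurStable (σ * A)) ∧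
    (GloballyExponentiallyStable (IsComparisonSubtrajectory graph A) ↔
      ∃ σ ∈ SigmaX n graph, SchurStable (σ * A)) := by
  have hle : GloballyExponentiallyStable (IsComparisonSubtrajectory graph A) →
      GloballyExponentiallyStable (IsComparisonTrajectory graph A) := by
    rintro ⟨c, lam, hc, h0, h1, h⟩
    exact ⟨c, lam, hc, h0, h1, fun e he => h e he.subtrajectory⟩
  have hex := exists_schurStable_of_stable (A := A) hnbr hA
  have hst := subtrajectory_stable_of_schurStable (graph := graph) hA
  exact ⟨⟨hex, fun h => hle (hst h)⟩, ⟨fun h => hex (hle h), hst⟩⟩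

end Selection

/-! ### Interval bounds -/

section Bounds

variable {κ ι : Type*}

lemma mPos_nonneg (M : Matrix κ ι ℝ) (a : κ) (b : ι) : 0 ≤ mPos M a b := le_max_right _ _

lemma mNeg_nonneg (M : Matrix κ ι ℝ) (a : κ) (b : ι) : 0 ≤ mNeg M a b :=
  sub_nonneg.2 (le_max_left _ _)

lemma mPos_sub_mNeg (M : Matrix κ ι ℝ) : mPos M - mNeg M = M := sub_sub_cancel _ _

lemma mAbs_nonneg (M : Matrix κ ι ℝ) (a : κ) (b : ι) : 0 ≤ mAbs M a b :=
  add_nonneg (mPos_nonneg M a b) (mNeg_nonneg M a b)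

lemma le_mAbs (M : Matrix κ ι ℝ) (a : κ) (b : ι) : M a b ≤ mAbs M a b :=
  (le_max_left _ _).trans (le_add_of_nonneg_right (mNeg_nonneg M a b))

variable [Fintype ι]

/-- Splitting `M` as a difference of two nonnegative matrices makes one part increasing and the
other decreasing in `u`. -/
lemma boundLo_le {M : Matrix κ ι ℝ} {hi lo u : ι → ℝ} (h : u ∈ Set.Icc lo hi) :
    boundLo M hi lo ≤ M *ᵥ u := by
  conv_rhs => rw [← mPos_sub_mNeg M, sub_mulVec]
  exact sub_le_sub (mulVec_mono_of_nonneg (mPos_nonneg M) h.1)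
    (mulVec_mono_of_nonneg (mNeg_nonneg M) h.2)

lemma le_boundHi {M : Matrix κ ι ℝ} {hi lo u : ι → ℝ} (h : u ∈ Set.Icc lo hi) :
    M *ᵥ u ≤ boundHi M hi lo := by
  conv_lhs => rw [← mPos_sub_mNeg M, sub_mulVec]
  exact sub_le_sub (mulVec_mono_of_nonneg (mPos_nonneg M) h.2)
    (mulVec_mono_of_nonneg (mNeg_nonneg M) h.1)

/-- The source of the absolute values in `Agent.Ax`. -/
lemma boundHi_sub_boundLo (M : Matrix κ ι ℝ) (hi lo : ι → ℝ) :
    boundHi M hi lo - boundLo M hi lo = mAbs M *ᵥ (hi - lo) := by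
  simp only [boundHi, boundLo, mAbs, add_mulVec, mulVec_sub]
  abel

lemma mulVec_le_mulLo_mulHi {n : Type*} (P : Matrix κ ι ℝ) (lo hi : Matrix ι n ℝ) (j : n)
    {c : ι → ℝ} (hc : ∀ i, c i ∈ Set.Icc (lo i j) (hi i j)) (s : κ) :
    (P *ᵥ c) s ∈ Set.Icc (mulLo P lo hi s j) (mulHi P lo hi s j) := by
  have h : c ∈ Set.Icc (fun i => lo i j) (fun i => hi i j) := ⟨fun i => (hc i).1, fun i => (hc i).2⟩
  exact ⟨boundLo_le h s, le_boundHi h s⟩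

end Bounds

/-! ### Tight decomposition functions -/

section Decomposition

variable {m n nw : ℕ}

/-- `g` is differentiable on `D` and the entries of its Jacobians lie between the given bounds. -/
def HasJacobianBounds (g : (Fin n → ℝ) → (Fin nw → ℝ) → (Fin m → ℝ))
    (D : Set ((Fin n → ℝ) × (Fin nw → ℝ))) (Lx Hx : Matrix (Fin m) (Fin n) ℝ)
    (Lw Hw : Matrix (Fin m) (Fin nw) ℝ) : Prop :=
  ∀ z ∈ D, ∃ J : ((Fin n → ℝ) × (Fin nw → ℝ)) →L[ℝ] (Fin m → ℝ),
    HasFDerivWithinAt (fun y : (Fin n → ℝ) × (Fin nw → ℝ) => g y.1 y.2) J D z ∧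
    (∀ s j, J (Pi.single j 1, 0) s ∈ Set.Icc (Lx s j) (Hx s j)) ∧
    (∀ s j, J (0, Pi.single j 1) s ∈ Set.Icc (Lw s j) (Hw s j))

/-- Jacobian bounds of `P f(x, w) + R x + R' w`. -/
lemma Target.HasBoundedJacobian.affine {p : ℕ} {S : Target n p nw} (hJac : S.HasBoundedJacobian)
    {D : Set ((Fin n → ℝ) × (Fin nw → ℝ))} (hD : D ⊆ S.X ×ˢ S.W)
    (P : Matrix (Fin m) (Fin n) ℝ) (R : Matrix (Fin m) (Fin n) ℝ) (R' : Matrix (Fin m) (Fin nw) ℝ) :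
    HasJacobianBounds (fun x w => P *ᵥ S.f x w + R *ᵥ x + R' *ᵥ w) D
      (mulLo P S.JxLo S.JxHi + R) (mulHi P S.JxLo S.JxHi + R)
      (mulLo P S.JwLo S.JwHi + R') (mulHi P S.JwLo S.JwHi + R') := by
  intro z hz
  obtain ⟨J, hJ, hx, hw⟩ := hJac z (hD hz)
  let mv : ∀ {k l : ℕ}, Matrix (Fin k) (Fin l) ℝ → (Fin l → ℝ) →L[ℝ] (Fin k → ℝ) :=
    fun M => (Matrix.mulVecLin M).toContinuousLinearMap
  refine ⟨(mv P).comp J + (mv R).comp (ContinuousLinearMap.fst ℝ _ _) +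
    (mv R').comp (ContinuousLinearMap.snd ℝ _ _), ?_, fun s j => ?_, fun s j => ?_⟩
  · refine HasFDerivWithinAt.add (HasFDerivWithinAt.add ?_ ?_) ?_
    · exact (mv P).hasFDerivAt.comp_hasFDerivWithinAt z (hJ.mono hD)
    · exact (mv R).hasFDerivAt.comp_hasFDerivWithinAt z hasFDerivWithinAt_fst
    · exact (mv R').hasFDerivAt.comp_hasFDerivWithinAt z hasFDerivWithinAt_snd
  · have h := mulVec_le_mulLo_mulHi P S.JxLo S.JxHi j (fun i => hx i j) s
    simp only [mv, _root_.add_apply, ContinuousLinearMap.comp_apply,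
      ContinuousLinearMap.coe_fst', ContinuousLinearMap.coe_snd', Pi.add_apply, Matrix.add_apply,
      LinearMap.coe_toContinuousLinearMap', mulVecLin_apply, mulVec_zero, Pi.zero_apply, add_zero,
      mulVec_single_one, Matrix.col_apply]
    exact ⟨by linarith [h.1], by linarith [h.2]⟩
  · have h := mulVec_le_mulLo_mulHi P S.JwLo S.JwHi j (fun i => hw i j) s
    simp only [mv, _root_.add_apply, ContinuousLinearMap.comp_apply,
      ContinuousLinearMap.coe_fst', ContinuousLinearMap.coe_snd', Pi.add_apply, Matrix.add_apply,
      LinearMap.coe_toContinuousLinearMap', mulVecLin_apply, mulVec_zero, add_zero,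
      mulVec_single_one, Matrix.col_apply]
    exact ⟨by linarith [h.1], by linarith [h.2]⟩

variable {g : (Fin n → ℝ) → (Fin nw → ℝ) → (Fin m → ℝ)}
  {Lx Hx : Matrix (Fin m) (Fin n) ℝ} {Lw Hw : Matrix (Fin m) (Fin nw) ℝ}
  {xl xh : Fin n → ℝ} {wl wh : Fin nw → ℝ}

/-- Mean value theorem in coordinates. -/
lemma HasJacobianBounds.mean_value {D : Set ((Fin n → ℝ) × (Fin nw → ℝ))}
    (hg : HasJacobianBounds g D Lx Hx Lw Hw) (hD : Convex ℝ D) {x₁ x₂ : Fin n → ℝ}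
    {w₁ w₂ : Fin nw → ℝ} (h₁ : (x₁, w₁) ∈ D) (h₂ : (x₂, w₂) ∈ D) (s : Fin m) :
    ∃ (a : Fin n → ℝ) (b : Fin nw → ℝ), (∀ j, a j ∈ Set.Icc (Lx s j) (Hx s j)) ∧
      (∀ j, b j ∈ Set.Icc (Lw s j) (Hw s j)) ∧
      g x₁ w₁ s - g x₂ w₂ s = ∑ j, a j * (x₁ j - x₂ j) + ∑ j, b j * (w₁ j - w₂ j) := by
  choose! J hJ hx hw using hg
  have hs : ∀ z ∈ D, HasFDerivWithinAt (fun y : (Fin n → ℝ) × (Fin nw → ℝ) => g y.1 y.2 s)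
      ((ContinuousLinearMap.proj s).comp (J z)) D z := fun z hz =>
    hasFDerivWithinAt_pi'.1 (hJ z hz) s
  -- The mean value theorem holds only for scalar components, so the intermediate point, and with it
  -- `a` and `b`, depends on `s`.
  obtain ⟨z, hz, h⟩ := domain_mvt hs hD h₂ h₁
  have hzD : z ∈ D := hD.segment_subset h₂ h₁ hz
  refine ⟨_, _, hx z hzD s, hw z hzD s, ?_⟩
  have hdec : ((x₁, w₁) - (x₂, w₂) : (Fin n → ℝ) × (Fin nw → ℝ)) =
      ∑ j, (x₁ j - x₂ j) • ((Pi.single j 1, 0) : (Fin n → ℝ) × (Fin nw → ℝ)) +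
      ∑ j, (w₁ j - w₂ j) • ((0, Pi.single j 1) : (Fin n → ℝ) × (Fin nw → ℝ)) := by
    ext i
    · simp [Prod.fst_sum, Finset.sum_apply, Pi.single_apply]
    · simp [Prod.snd_sum, Finset.sum_apply, Pi.single_apply]
  have h' : g x₁ w₁ s - g x₂ w₂ s = J z ((x₁, w₁) - (x₂, w₂)) s := h
  rw [h', hdec, map_add, map_sum, map_sum]
  simp only [map_smul, Pi.add_apply, Finset.sum_apply, Pi.smul_apply, smul_eq_mul, mul_comm]

lemma selPattern_eq {k : ℕ} (J : Matrix (Fin m) (Fin k) ℝ) (s : Fin m) (j : Fin k) :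
    (0 < J s j ∧ selPattern J s j = 1) ∨ (J s j ≤ 0 ∧ selPattern J s j = 0) := by
  unfold selPattern
  rcases lt_trichotomy (J s j) 0 with h | h | h
  · right; simp [h.le, Real.sign_of_neg h]
  · right; simp [h]
  · left; simp [h, Real.sign_of_pos h]

lemma convexCombo_mem_Icc {k : ℕ} (J : Matrix (Fin m) (Fin k) ℝ) (s : Fin m)
    {lo hi u v : Fin k → ℝ} (hu : u ∈ Set.Icc lo hi) (hv : v ∈ Set.Icc lo hi) :
    (fun j => selPattern J s j * u j + (1 - selPattern J s j) * v j) ∈ Set.Icc lo hi := by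
  constructor <;> intro j <;> rcases selPattern_eq J s j with ⟨-, h⟩ | ⟨-, h⟩ <;> simp only [h]
  · simpa using hu.1 j
  · simpa using hv.1 j
  · simpa using hu.2 j
  · simpa using hv.2 j

/-- Sign of a term of the mean value expansion against a selected end point. -/
lemma selPattern_term_nonneg {k : ℕ} {L H : Matrix (Fin m) (Fin k) ℝ} {s : Fin m} {j : Fin k}
    (hLH : L s j = 0 ∨ H s j = 0) {a lo hi u : ℝ} (ha : a ∈ Set.Icc (L s j) (H s j))
    (hu : u ∈ Set.Icc lo hi) :
    0 ≤ a * (selPattern H s j * hi + (1 - selPattern H s j) * lo - u) ∧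
    0 ≤ a * (u - (selPattern H s j * lo + (1 - selPattern H s j) * hi)) := by
  rcases selPattern_eq H s j with ⟨h0, h⟩ | ⟨h0, h⟩ <;> rw [h]
  · have hL : L s j = 0 := hLH.resolve_right h0.ne'
    have ha0 : 0 ≤ a := hL ▸ ha.1
    exact ⟨mul_nonneg ha0 (by linarith [hu.2]), mul_nonneg ha0 (by linarith [hu.1])⟩
  · have ha0 : a ≤ 0 := ha.2.trans h0
    exact ⟨mul_nonneg_of_nonpos_of_nonpos ha0 (by linarith [hu.1]),
      mul_nonneg_of_nonpos_of_nonpos ha0 (by linarith [hu.2])⟩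

lemma selPattern_term_le {k : ℕ} {L H : Matrix (Fin m) (Fin k) ℝ} {s : Fin m} {j : Fin k}
    (hLH : L s j = 0 ∨ H s j = 0) {a lo hi : ℝ} (ha : a ∈ Set.Icc (L s j) (H s j))
    (h : lo ≤ hi) :
    a * ((selPattern H s j * hi + (1 - selPattern H s j) * lo) -
      (selPattern H s j * lo + (1 - selPattern H s j) * hi)) ≤ (H - L) s j * (hi - lo) := by
  have hd : 0 ≤ hi - lo := sub_nonneg.2 h
  rw [Matrix.sub_apply]
  rcases selPattern_eq H s j with ⟨h0, hs⟩ | ⟨h0, hs⟩ <;> rw [hs]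
  · have hL : L s j = 0 := hLH.resolve_right h0.ne'
    have := mul_le_mul_of_nonneg_right (show a ≤ H s j - L s j by linarith [ha.2]) hd
    linarith
  -- Here `hi` and `lo` are swapped, so the factor of `hi - lo` is `-a`.
  · have : -a ≤ H s j - L s j := by
      rcases hLH with h1 | h1 <;> linarith [ha.1, ha.2]
    have := mul_le_mul_of_nonneg_right this hd
    linarith

variable (hg : HasJacobianBounds g (Set.Icc xl xh ×ˢ Set.Icc wl wh) Lx Hx Lw Hw)
  (hx : ∀ s j, Lx s j = 0 ∨ Hx s j = 0) (hw : ∀ s j, Lw s j = 0 ∨ Hw s j = 0)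
include hg hx hw

/-- The tight decomposition function of a Jacobian sign-stable map frames the map. -/
lemma HasJacobianBounds.mem_decomp {x : Fin n → ℝ} {w : Fin nw → ℝ}
    (hxm : x ∈ Set.Icc xl xh) (hwm : w ∈ Set.Icc wl wh) :
    g x w ∈ Set.Icc (decomp g (selPattern Hx) (selPattern Hw) xl wl xh wh)
      (decomp g (selPattern Hx) (selPattern Hw) xh wh xl wl) := by
  have hxle := hxm.1.trans hxm.2
  have hwle := hwm.1.trans hwm.2
  have hconv : Convex ℝ (Set.Icc xl xh ×ˢ Set.Icc wl wh) :=
    (convex_Icc xl xh).prod (convex_Icc wl wh)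
  constructor <;> intro s
  -- The comparison is with the corner selected for row `s`: sign stability makes every term of the
  -- expansion nonnegative.
  · obtain ⟨a, b, ha, hb, h⟩ := hg.mean_value hconv ⟨hxm, hwm⟩
      ⟨convexCombo_mem_Icc Hx s (Set.left_mem_Icc.2 hxle) (Set.right_mem_Icc.2 hxle),
        convexCombo_mem_Icc Hw s (Set.left_mem_Icc.2 hwle) (Set.right_mem_Icc.2 hwle)⟩ s
    rw [← sub_nonneg, decomp, h]
    exact add_nonneg (Finset.sum_nonneg fun j _ =>
        (selPattern_term_nonneg (hx s j) (ha j) ⟨hxm.1 j, hxm.2 j⟩).2)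
      (Finset.sum_nonneg fun j _ =>
        (selPattern_term_nonneg (hw s j) (hb j) ⟨hwm.1 j, hwm.2 j⟩).2)
  · obtain ⟨a, b, ha, hb, h⟩ := hg.mean_value hconv
      ⟨convexCombo_mem_Icc Hx s (Set.right_mem_Icc.2 hxle) (Set.left_mem_Icc.2 hxle),
        convexCombo_mem_Icc Hw s (Set.right_mem_Icc.2 hwle) (Set.left_mem_Icc.2 hwle)⟩
      ⟨hxm, hwm⟩ s
    rw [← sub_nonneg, decomp, h]
    exact add_nonneg (Finset.sum_nonneg fun j _ =>
        (selPattern_term_nonneg (hx s j) (ha j) ⟨hxm.1 j, hxm.2 j⟩).1)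
      (Finset.sum_nonneg fun j _ =>
        (selPattern_term_nonneg (hw s j) (hb j) ⟨hwm.1 j, hwm.2 j⟩).1)

/-- The width of the tight decomposition function. -/
lemma HasJacobianBounds.decomp_sub_le (hxle : xl ≤ xh) (hwle : wl ≤ wh) :
    decomp g (selPattern Hx) (selPattern Hw) xh wh xl wl -
      decomp g (selPattern Hx) (selPattern Hw) xl wl xh wh ≤
    (Hx - Lx) *ᵥ (xh - xl) + (Hw - Lw) *ᵥ (wh - wl) := by
  have hconv : Convex ℝ (Set.Icc xl xh ×ˢ Set.Icc wl wh) :=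
    (convex_Icc xl xh).prod (convex_Icc wl wh)
  intro s
  obtain ⟨a, b, ha, hb, h⟩ := hg.mean_value hconv
    ⟨convexCombo_mem_Icc Hx s (Set.right_mem_Icc.2 hxle) (Set.left_mem_Icc.2 hxle),
      convexCombo_mem_Icc Hw s (Set.right_mem_Icc.2 hwle) (Set.left_mem_Icc.2 hwle)⟩
    ⟨convexCombo_mem_Icc Hx s (Set.left_mem_Icc.2 hxle) (Set.right_mem_Icc.2 hxle),
      convexCombo_mem_Icc Hw s (Set.left_mem_Icc.2 hwle) (Set.right_mem_Icc.2 hwle)⟩ s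
  rw [Pi.sub_apply, decomp, decomp, h]
  exact add_le_add
    (Finset.sum_le_sum fun j _ => selPattern_term_le (hx s j) (ha j) (hxle j))
    (Finset.sum_le_sum fun j _ => selPattern_term_le (hw s j) (hb j) (hwle j))

end Decomposition

/-! ### Singular value decomposition and elimination of the unknown input -/

section Output

namespace SVD

variable {l p : ℕ} {H : Matrix (Fin l) (Fin p) ℝ} (s : SVD H)

lemma U₁_transpose_mul_U₁ : s.U₁ᵀ * s.U₁ = 1 := by
  have h := s.U_left
  rw [transpose_fromCols, fromRows_mul_fromCols, ← fromBlocks_one] at h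
  exact (fromBlocks_inj.1 h).1

lemma U₂_transpose_mul_U₁ : s.U₂ᵀ * s.U₁ = 0 := by
  have h := s.U_left
  rw [transpose_fromCols, fromRows_mul_fromCols, ← fromBlocks_one] at h
  exact (fromBlocks_inj.1 h).2.2.1

lemma V_decomposition : s.V₁ * s.V₁ᵀ + s.V₂ * s.V₂ᵀ = 1 := by
  have h := s.V_right
  rwa [transpose_fromCols, fromCols_mul_fromRows] at h

lemma eq_reduced : H = s.U₁ * diagonal s.ξ * s.V₁ᵀ := by
  have h := s.eq_mul
  rw [fromCols_mul_fromBlocks, transpose_fromCols, fromCols_mul_fromRows] at h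
  simpa using h

lemma U₁_transpose_mul : s.U₁ᵀ * H = diagonal s.ξ * s.V₁ᵀ := by
  refine (congrArg (s.U₁ᵀ * ·) s.eq_reduced).trans ?_
  rw [← Matrix.mul_assoc, ← Matrix.mul_assoc, s.U₁_transpose_mul_U₁, Matrix.one_mul]

/-- The second output channel is therefore free of the current input. -/
lemma U₂_transpose_mul : s.U₂ᵀ * H = 0 := by
  refine (congrArg (s.U₂ᵀ * ·) s.eq_reduced).trans ?_
  rw [← Matrix.mul_assoc, ← Matrix.mul_assoc, s.U₂_transpose_mul_U₁, Matrix.zero_mul,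
    Matrix.zero_mul]

end SVD

/-- The Moore–Penrose inverse of a matrix with full column rank is a left inverse. -/
lemma pinv_mul {l k : ℕ} {K : Matrix (Fin l) (Fin k) ℝ} (h : K.rank = k) : pinv K * K = 1 := by
  have hu : IsUnit (Kᵀ * K) := by
    -- Over the reals the Gram matrix has the rank of `K`, hence full rank.
    rw [← mulVec_surjective_iff_isUnit, ← coe_mulVecLin, ← LinearMap.range_eq_top]
    refine Submodule.eq_top_of_finrank_eq ?_
    rw [Module.finrank_fin_fun]
    exact (rank_transpose_mul_self K).trans h
  rw [pinv, Matrix.mul_assoc]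
  exact nonsing_inv_mul _ ((isUnit_iff_isUnit_det _).1 hu)

namespace Agent

variable {n p nw : ℕ} (a : Agent n p nw) (S : Target n p nw)

lemma M₁_mul : a.M₁ * diagonal a.svd.ξ = 1 := by
  refine nonsing_inv_mul _ ?_
  rw [det_diagonal, isUnit_iff_ne_zero]
  exact Finset.prod_ne_zero_iff.2 fun j _ => a.svd.ξ_ne_zero j

variable {a S}

/-- The first output channel measures `V₁ᵀ d` directly, up to state and noise terms. -/
lemma M₁_mulVec (d : Fin p → ℝ) (x : Fin n → ℝ) (v : Fin a.nv → ℝ) :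
    a.M₁ *ᵥ (a.svd.U₁ᵀ *ᵥ (a.C *ᵥ x + a.D *ᵥ v + a.H *ᵥ d)) =
      a.M₁ *ᵥ (a.C₁ *ᵥ x) + a.M₁ *ᵥ (a.D₁ *ᵥ v) + a.svd.V₁ᵀ *ᵥ d := by
  simp only [mulVec_add]
  rw [mulVec_mulVec d, a.svd.U₁_transpose_mul, mulVec_mulVec d, ← Matrix.mul_assoc, a.M₁_mul,
    Matrix.one_mul]
  simp only [C₁, D₁, mulVec_mulVec]

lemma U₂_mulVec (d : Fin p → ℝ) (x : Fin n → ℝ) (v : Fin a.nv → ℝ) :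
    a.svd.U₂ᵀ *ᵥ (a.C *ᵥ x + a.D *ᵥ v + a.H *ᵥ d) = a.C₂ *ᵥ x + a.D₂ *ᵥ v := by
  simp only [mulVec_add, C₂, D₂, mulVec_mulVec]
  rw [a.svd.U₂_transpose_mul, zero_mulVec, add_zero]

lemma M₂_mulVec (hrank : a.FullColumnRank S) (u : Fin a.svd.p₂ → ℝ) :
    a.M₂ S *ᵥ (a.C₂ *ᵥ (a.G₂ S *ᵥ u)) = u := by
  rw [mulVec_mulVec u, mulVec_mulVec u, M₂, pinv_mul hrank, one_mulVec]

lemma input_split (d : Fin p → ℝ) :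
    a.svd.V₁ *ᵥ (a.svd.V₁ᵀ *ᵥ d) + a.svd.V₂ *ᵥ (a.svd.V₂ᵀ *ᵥ d) = d := by
  rw [mulVec_mulVec d, mulVec_mulVec d, ← add_mulVec, a.svd.V_decomposition, one_mulVec]

lemma G_mulVec (d : Fin p → ℝ) :
    S.G *ᵥ d = a.G₁ S *ᵥ (a.svd.V₁ᵀ *ᵥ d) + a.G₂ S *ᵥ (a.svd.V₂ᵀ *ᵥ d) := by
  conv_lhs => rw [← a.input_split d]
  simp only [mulVec_add, G₁, G₂, mulVec_mulVec, Matrix.mul_assoc]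

/-- `(w, v, v')` as one vector. -/
def noiseVec (w : Fin nw → ℝ) (v v' : Fin a.nv → ℝ) : (Fin nw ⊕ Fin a.nv) ⊕ Fin a.nv → ℝ :=
  Sum.elim (Sum.elim w v) v'

lemma noiseVec_mem {w wl wh : Fin nw → ℝ} {v v' vl vh : Fin a.nv → ℝ} (hw : w ∈ Set.Icc wl wh)
    (hv : v ∈ Set.Icc vl vh) (hv' : v' ∈ Set.Icc vl vh) :
    noiseVec w v v' ∈ Set.Icc (a.ηvec wl vl) (a.ηvec wh vh) := by
  constructor
  · rintro ((j | j) | j)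
    exacts [hw.1 j, hv.1 j, hv'.1 j]
  · rintro ((j | j) | j)
    exacts [hw.2 j, hv.2 j, hv'.2 j]

variable {x x' : Fin n → ℝ} {w : Fin nw → ℝ} {d d' : Fin p → ℝ} {v v' : Fin a.nv → ℝ}

/-- Elimination of the unknown input from the state equation. -/
lemma state_identity (hrank : a.FullColumnRank S) (hx' : x' = S.f x w + S.G *ᵥ d) :
    x' = a.Atilde *ᵥ x + a.T *ᵥ a.ρ S x w + a.Ψ S *ᵥ noiseVec w v v' +
      a.ζ S (a.C *ᵥ x + a.D *ᵥ v + a.H *ᵥ d) (a.C *ᵥ x' + a.D *ᵥ v' + a.H *ᵥ d') := by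
  -- The component `V₂ᵀ d` is invisible in the current output; it is recovered from `C₂ x'`, that
  -- is, from the next measurement.
  have hGM : a.G₂ S *ᵥ (a.M₂ S *ᵥ (a.C₂ *ᵥ x')) =
      a.G₂ S *ᵥ (a.M₂ S *ᵥ (a.C₂ *ᵥ S.f x w)) +
      a.G₂ S *ᵥ (a.M₂ S *ᵥ (a.C₂ *ᵥ (a.G₁ S *ᵥ (a.svd.V₁ᵀ *ᵥ d)))) +
      a.G₂ S *ᵥ (a.svd.V₂ᵀ *ᵥ d) := by
    rw [hx', a.G_mulVec]
    simp only [mulVec_add, M₂_mulVec hrank]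
    abel
  have hx'' : S.f x w - a.G₂ S *ᵥ (a.M₂ S *ᵥ (a.C₂ *ᵥ S.f x w)) +
      (a.G₁ S *ᵥ (a.svd.V₁ᵀ *ᵥ d) -
        a.G₂ S *ᵥ (a.M₂ S *ᵥ (a.C₂ *ᵥ (a.G₁ S *ᵥ (a.svd.V₁ᵀ *ᵥ d))))) +
      a.G₂ S *ᵥ (a.M₂ S *ᵥ (a.C₂ *ᵥ x')) = x' := by
    rw [hGM]
    conv_rhs => rw [hx', a.G_mulVec]
    abel
  -- The gain `Γ` is free because `T + Γ C₂ = I` and `C₂ x'` is measured up to noise.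
  have hT : a.T *ᵥ x' + a.Γ *ᵥ (a.C₂ *ᵥ x') = x' := by
    simp only [T, sub_mulVec, one_mulVec, ← mulVec_mulVec]
    abel
  conv_lhs => rw [← hT]
  conv_lhs => enter [1]; rw [← hx'']
  simp only [ζ, Φ, ← mulVec_mulVec, M₁_mulVec, U₂_mulVec]
  simp only [Atilde, ρ, fi, Ψ, noiseVec, fromCols_mulVec, Φ, Sum.elim_comp_inl,
    Sum.elim_comp_inr, add_mulVec, sub_mulVec, neg_mulVec, ← mulVec_mulVec,
    mulVec_add, mulVec_sub, Q, one_mulVec]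
  abel

/-- Reconstruction of the unknown input. -/
lemma input_identity (hrank : a.FullColumnRank S) (hx' : x' = S.f x w + S.G *ᵥ d) :
    d = a.Ah *ᵥ x + a.μ S x w + a.Λ S *ᵥ noiseVec w v v' +
      a.ζd S (a.C *ᵥ x + a.D *ᵥ v + a.H *ᵥ d) (a.C *ᵥ x' + a.D *ᵥ v' + a.H *ᵥ d') := by
  have hM : a.M₂ S *ᵥ (a.C₂ *ᵥ x') =
      a.M₂ S *ᵥ (a.C₂ *ᵥ S.f x w) +
      a.M₂ S *ᵥ (a.C₂ *ᵥ (a.G₁ S *ᵥ (a.svd.V₁ᵀ *ᵥ d))) + a.svd.V₂ᵀ *ᵥ d := by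
    rw [hx', a.G_mulVec]
    simp only [mulVec_add, M₂_mulVec hrank]
    abel
  conv_lhs => rw [← a.input_split d]
  simp only [ζd, Υ, ← mulVec_mulVec, M₁_mulVec, U₂_mulVec]
  simp only [μ, h, Λ, noiseVec, fromCols_mulVec, Υ, Θ, Sum.elim_comp_inl,
    Sum.elim_comp_inr, sub_mulVec, neg_mulVec, ← mulVec_mulVec, mulVec_add, hM]
  abel

/-! ### Framers and errors of a single agent -/

/-- This is sign stability: once the linear part is removed, each entry interval of the Jacobian has
zero as an end point. -/
lemma endpoint_sub {k l : ℕ} {lo hi M : Matrix (Fin k) (Fin l) ℝ} (h : IsEndpointChoice lo hi M)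
    (s : Fin k) (j : Fin l) : (lo - M) s j = 0 ∨ (hi - M) s j = 0 :=
  (h s j).imp (fun h => by rw [Matrix.sub_apply, h, sub_self])
    fun h => by rw [Matrix.sub_apply, h, sub_self]

variable {D : Set ((Fin n → ℝ) × (Fin nw → ℝ))} {xl xh : Fin n → ℝ} {wl wh : Fin nw → ℝ}

lemma hasJacobianBounds_ρ (hJac : S.HasBoundedJacobian) (hD : D ⊆ S.X ×ˢ S.W) :
    HasJacobianBounds (a.ρ S) D (a.fiJxLo S - a.A) (a.fiJxHi S - a.A)
      (a.fiJwLo S - a.B) (a.fiJwHi S - a.B) := by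
  have h := hJac.affine hD (a.Q S) (-(a.Φ S * a.C₁) - a.A) (-a.B)
  convert h using 1
  · ext x w : 2
    simp only [ρ, fi, sub_mulVec, neg_mulVec]
    abel
  all_goals simp only [fiJxLo, fiJxHi, fiJwLo, fiJwHi]; abel

lemma hasJacobianBounds_μ (hJac : S.HasBoundedJacobian) (hD : D ⊆ S.X ×ˢ S.W) :
    HasJacobianBounds (a.μ S) D (a.hJxLo S - a.Ah) (a.hJxHi S - a.Ah)
      (a.hJwLo S - a.Ch) (a.hJwHi S - a.Ch) := by
  have h := hJac.affine hD (a.Θ S * a.C₂) (a.Υ S * a.C₁ - a.Ah) (-a.Ch)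
  convert h using 1
  · ext x w : 2
    simp only [μ, Agent.h, sub_mulVec, neg_mulVec]
    abel
  all_goals simp only [hJxLo, hJxHi, hJwLo, hJwHi]; abel

lemma ρ_mem (hJac : S.HasBoundedJacobian) (hJSS : a.IsJSSDecomposition S)
    (hX : Set.Icc xl xh ⊆ S.X) (hW : Set.Icc wl wh ⊆ S.W) (hx : x ∈ Set.Icc xl xh)
    (hw : w ∈ Set.Icc wl wh) :
    a.ρ S x w ∈ Set.Icc (a.ρd S xl wl xh wh) (a.ρd S xh wh xl wl) :=
  (hasJacobianBounds_ρ hJac (Set.prod_mono hX hW)).mem_decomp (endpoint_sub hJSS.1)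
    (endpoint_sub hJSS.2.1) hx hw

lemma μ_mem (hJac : S.HasBoundedJacobian) (hJSS : a.IsJSSDecomposition S)
    (hX : Set.Icc xl xh ⊆ S.X) (hW : Set.Icc wl wh ⊆ S.W) (hx : x ∈ Set.Icc xl xh)
    (hw : w ∈ Set.Icc wl wh) :
    a.μ S x w ∈ Set.Icc (a.μd S xl wl xh wh) (a.μd S xh wh xl wl) :=
  (hasJacobianBounds_μ hJac (Set.prod_mono hX hW)).mem_decomp (endpoint_sub hJSS.2.2.1)
    (endpoint_sub hJSS.2.2.2) hx hw

lemma Fρx_nonneg (s j : Fin n) : 0 ≤ a.Fρx S s j :=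
  add_nonneg (mPos_nonneg _ s j) (mNeg_nonneg _ s j)

lemma Ax_nonneg (s j : Fin n) : 0 ≤ a.Ax S s j :=
  add_nonneg (mAbs_nonneg _ s j) <| by
    rw [Matrix.mul_apply]
    exact Finset.sum_nonneg fun i _ => mul_nonneg (mAbs_nonneg _ s i) (Fρx_nonneg i j)

/-- The term `Φ C₁` cancels in the width, and `J̄ ≤ J̄^⊕`, `-J̲ ≤ J̲^⊖`. -/
lemma jacobian_width_le (s j : Fin n) : (a.fiJxHi S - a.fiJxLo S) s j ≤ a.Fρx S s j := by
  have h1 : mulHi (a.Q S) S.JxLo S.JxHi s j ≤ mPos (mulHi (a.Q S) S.JxLo S.JxHi) s j :=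
    le_max_left _ _
  have h2 : 0 ≤ mPos (mulLo (a.Q S) S.JxLo S.JxHi) s j := mPos_nonneg _ s j
  simp only [fiJxHi, fiJxLo, Fρx, mNeg, Matrix.sub_apply, Matrix.add_apply]
  linarith

lemma ρd_width_le (hJac : S.HasBoundedJacobian) (hJSS : a.IsJSSDecomposition S)
    (hX : Set.Icc xl xh ⊆ S.X) (hW : Set.Icc wl wh ⊆ S.W) (hx : xl ≤ xh) (hw : wl ≤ wh) :
    a.ρd S xh wh xl wl - a.ρd S xl wl xh wh ≤
      a.Fρx S *ᵥ (xh - xl) + mAbs (a.fiJwHi S - a.fiJwLo S) *ᵥ (wh - wl) := by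
  refine ((hasJacobianBounds_ρ hJac (Set.prod_mono hX hW)).decomp_sub_le (endpoint_sub hJSS.1)
    (endpoint_sub hJSS.2.1) hx hw).trans ?_
  -- The linear parts `A` and `B` drop out of the Jacobian widths.
  simp only [sub_sub_sub_cancel_right]
  exact add_le_add (mulVec_le_mulVec_of_le jacobian_width_le (sub_nonneg.2 hx))
    (mulVec_le_mulVec_of_le (le_mAbs _) (sub_nonneg.2 hw))

variable (a S) in
/-- The response of the local state framer error to noise intervals of unit width. -/
def noiseGain : Fin n → ℝ :=
  mAbs a.T *ᵥ (mAbs (a.fiJwHi S - a.fiJwLo S) *ᵥ 1) + mAbs (a.Ψ S) *ᵥ 1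

/-- Propagation of the width of the local state framers. -/
lemma local_error_le (hJac : S.HasBoundedJacobian) (hJSS : a.IsJSSDecomposition S)
    (hX : Set.Icc xl xh ⊆ S.X) (hW : Set.Icc wl wh ⊆ S.W) (hx : xl ≤ xh) (hw : wl ≤ wh)
    {vl vh : Fin a.nv → ℝ} {δ : ℝ} (hwδ : ∀ j, wh j - wl j ≤ δ) (hvδ : ∀ j, vh j - vl j ≤ δ)
    (z : Fin n → ℝ) :
    (boundHi a.Atilde xh xl + boundHi a.T (a.ρd S xh wh xl wl) (a.ρd S xl wl xh wh) +
      boundHi (a.Ψ S) (a.ηvec wh vh) (a.ηvec wl vl) + z) -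
    (boundLo a.Atilde xh xl + boundLo a.T (a.ρd S xh wh xl wl) (a.ρd S xl wl xh wh) +
      boundLo (a.Ψ S) (a.ηvec wh vh) (a.ηvec wl vl) + z) ≤
    a.Ax S *ᵥ (xh - xl) + δ • a.noiseGain S := by
  have hsplit : ∀ a₁ a₂ a₃ b₁ b₂ b₃ : Fin n → ℝ, (a₁ + a₂ + a₃ + z) - (b₁ + b₂ + b₃ + z) =
      (a₁ - b₁) + (a₂ - b₂) + (a₃ - b₃) := fun _ _ _ _ _ _ => by abel
  rw [hsplit, boundHi_sub_boundLo, boundHi_sub_boundLo, boundHi_sub_boundLo]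
  have h1 : wh - wl ≤ δ • (1 : Fin nw → ℝ) := fun j => by simpa using hwδ j
  have h2 : a.ηvec wh vh - a.ηvec wl vl ≤ δ • 1 := by
    rintro ((j | j) | j)
    · simpa [ηvec] using hwδ j
    · simpa [ηvec] using hvδ j
    · simpa [ηvec] using hvδ j
  have h3 := mulVec_mono_of_nonneg (mAbs_nonneg (a.Ψ S)) h2
  have h4 := mulVec_mono_of_nonneg (mAbs_nonneg (a.fiJwHi S - a.fiJwLo S)) h1
  have h5 := mulVec_mono_of_nonneg (mAbs_nonneg a.T)
    ((ρd_width_le hJac hJSS hX hW hx hw).trans (add_le_add_right h4 _))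
  refine (add_le_add (add_le_add_right h5 _) h3).trans (le_of_eq ?_)
  simp only [Ax, noiseGain, add_mulVec, mulVec_add, mulVec_smul, mulVec_mulVec, smul_add]
  abel

end Agent

end Output

/-! ### The distributed observer -/

section Observer

variable {N n p nw : ℕ} {graph : Digraph (Fin N)} {S : Target n p nw}
  {agent : Fin N → Agent n p nw} {nb : NoiseBounds agent} {P : PlantRun S agent nb}

lemma collectiveAx_nonneg (a b : Fin N × Fin n) : 0 ≤ collectiveAx S agent a b := by
  simp only [collectiveAx, of_apply]
  split_ifs
  · exact Agent.Ax_nonneg _ _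
  · exact le_rfl

lemma collectiveAx_mulVec (e : Fin N × Fin n → ℝ) (i : Fin N) (s : Fin n) :
    (collectiveAx S agent *ᵥ e) (i, s) = ((agent i).Ax S *ᵥ fun t => e (i, t)) s := by
  simp only [mulVec, dotProduct, collectiveAx, of_apply, Fintype.sum_prod_type, ite_mul, zero_mul]
  rw [Finset.sum_eq_single i]
  · simp
  · intro j _ hj
    simp [hj.symm]
  · simp

lemma NoiseBounds.wWidth_le (nb : NoiseBounds agent) (j : Fin nw) :
    nb.wHi j - nb.wLo j ≤ l2norm nb.width :=
  (le_abs_self _).trans (abs_le_l2norm nb.width (Sum.inl j))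

lemma NoiseBounds.vWidth_le (nb : NoiseBounds agent) (i : Fin N) (j : Fin (agent i).nv) :
    nb.vHi i j - nb.vLo i j ≤ l2norm nb.width :=
  (le_abs_self _).trans (abs_le_l2norm nb.width (Sum.inr ⟨i, j⟩))

/-! ### Correctness of the framers and the error inequality -/

namespace ObserverRun

variable (O : ObserverRun graph P)

lemma InDomain.mono {O : ObserverRun graph P} {k l : ℕ} (h : O.InDomain k) (hl : l ≤ k) :
    O.InDomain l := fun m hm => h m (hm.trans hl)

variable (hJac : S.HasBoundedJacobian) (hrank : ∀ i, (agent i).FullColumnRank S)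
  (hJSS : ∀ i, (agent i).IsJSSDecomposition S) (hW : Set.Icc nb.wLo nb.wHi ⊆ S.W)
include hJac hrank hJSS hW

/-- The eliminated state equation has the same summands as the observer, so each is framed
separately and the measured term `ζ` is common to both bounds. -/
lemma local_state_framer {k : ℕ} {i : Fin N} (hX : Set.Icc (O.xLo i k) (O.xHi i k) ⊆ S.X)
    (hx : P.x k ∈ Set.Icc (O.xLo i k) (O.xHi i k)) :
    P.x (k + 1) ∈ Set.Icc (O.x0Lo i (k + 1)) (O.x0Hi i (k + 1)) := by
  have hρ := (agent i).ρ_mem hJac (hJSS i) hX hW hx (P.w_mem k)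
  have hη := Agent.noiseVec_mem (P.w_mem k) (P.v_mem i k) (P.v_mem i (k + 1))
  have hid := Agent.state_identity (d' := P.d (k + 1)) (v := P.v i k) (v' := P.v i (k + 1))
    (hrank i) (P.dynamics k)
  rw [O.step_x0Lo, O.step_x0Hi, hid]
  exact ⟨add_le_add (add_le_add (add_le_add (boundLo_le hx) (boundLo_le hρ)) (boundLo_le hη)) le_rfl,
    add_le_add (add_le_add (add_le_add (le_boundHi hx) (le_boundHi hρ)) (le_boundHi hη)) le_rfl⟩

lemma local_input_framer {k : ℕ} {i : Fin N} (hX : Set.Icc (O.xLo i k) (O.xHi i k) ⊆ S.X)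
    (hx : P.x k ∈ Set.Icc (O.xLo i k) (O.xHi i k)) :
    P.d k ∈ Set.Icc (O.d0Lo i k) (O.d0Hi i k) := by
  have hμ := (agent i).μ_mem hJac (hJSS i) hX hW hx (P.w_mem k)
  have hη := Agent.noiseVec_mem (P.w_mem k) (P.v_mem i k) (P.v_mem i (k + 1))
  have hid := Agent.input_identity (d' := P.d (k + 1)) (v := P.v i k) (v' := P.v i (k + 1))
    (hrank i) (P.dynamics k)
  rw [O.step_d0Lo, O.step_d0Hi]
  constructor
  · refine le_of_le_of_eq ?_ hid.symm
    exact add_le_add (add_le_add (add_le_add (boundLo_le hx) hμ.1) (boundLo_le hη)) le_rfl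
  · refine le_of_eq_of_le hid ?_
    exact add_le_add (add_le_add (add_le_add (le_boundHi hx) hμ.2) (le_boundHi hη)) le_rfl

lemma state_framer {k : ℕ} (hO : O.InDomain k) (i : Fin N) :
    P.x k ∈ Set.Icc (O.xLo i k) (O.xHi i k) := by
  induction k generalizing i with
  | zero => exact O.init i
  | succ k ih =>
    have hloc := fun j => O.local_state_framer hJac hrank hJSS hW
      (hO k (Nat.le_succ k) j) (ih (hO.mono (Nat.le_succ k)) j)
    constructor <;> intro s
    -- The network maximum is attained by some neighbour, whose local framer is already correct.
    · obtain ⟨j, -, h⟩ := (O.step_xLo i k s).1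
      exact le_of_eq_of_le h.symm ((hloc j).1 s)
    · obtain ⟨j, -, h⟩ := (O.step_xHi i k s).1
      exact le_of_le_of_eq ((hloc j).2 s) h

lemma input_framer {k : ℕ} (hO : O.InDomain k) (i : Fin N) :
    P.d k ∈ Set.Icc (O.dLo i k) (O.dHi i k) := by
  have hloc := fun j => O.local_input_framer hJac hrank hJSS hW
    (hO k le_rfl j) (O.state_framer hJac hrank hJSS hW hO j)
  constructor <;> intro s
  · obtain ⟨j, -, h⟩ := (O.step_dLo i k s).1
    exact le_of_eq_of_le h.symm ((hloc j).1 s)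
  · obtain ⟨j, -, h⟩ := (O.step_dHi i k s).1
    exact le_of_le_of_eq ((hloc j).2 s) h

lemma ex_nonneg {k : ℕ} (hO : O.InDomain k) : 0 ≤ O.ex k := fun q =>
  have h := O.state_framer hJac hrank hJSS hW hO q.1
  sub_nonneg.2 (h.1.trans h.2 q.2)

/-- The collective state framer error satisfies a perturbed linear comparison inequality for
every network selection. -/
lemma ex_succ_le {k : ℕ} (hO : O.InDomain k) {σ : Matrix (Fin N × Fin n) (Fin N × Fin n) ℝ}
    (hσ : σ ∈ SigmaX n graph) :
    O.ex (k + 1) ≤ (σ * collectiveAx S agent) *ᵥ O.ex k +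
      l2norm nb.width • (σ *ᵥ fun q => (agent q.1).noiseGain S q.2) := by
  obtain ⟨φ, hφ, rfl⟩ := exists_eq_selMatrix hσ
  rintro ⟨i, s⟩
  rw [← mulVec_mulVec, Pi.add_apply, Pi.smul_apply, selMatrix_mulVec, selMatrix_mulVec,
    collectiveAx_mulVec]
  set j := φ (i, s)
  -- Upper and lower framers may come from different neighbours; both are at least as tight as those
  -- of the one neighbour `j` chosen by `σ`.
  have hhi : O.xHi i (k + 1) s ≤ O.x0Hi j (k + 1) s := (O.step_xHi i k s).2 ⟨j, hφ (i, s), rfl⟩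
  have hlo : O.x0Lo j (k + 1) s ≤ O.xLo i (k + 1) s := (O.step_xLo i k s).2 ⟨j, hφ (i, s), rfl⟩
  have hx := O.state_framer hJac hrank hJSS hW hO j
  -- Any time would do: only `wLo ≤ wHi` is extracted.
  have hw := P.w_mem 0
  have h := Agent.local_error_le hJac (hJSS j) (hO k le_rfl j) hW (hx.1.trans hx.2)
    (hw.1.trans hw.2) nb.wWidth_le (nb.vWidth_le j)
    ((agent j).ζ S (P.y j k) (P.y j (k + 1))) s
  rw [← O.step_x0Hi, ← O.step_x0Lo] at h
  exact (sub_le_sub hhi hlo).trans h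

end ObserverRun

/-- The observer is a distributed resilient interval framer. -/
theorem isResilientFramer (hJac : S.HasBoundedJacobian)
    (hrank : ∀ i, (agent i).FullColumnRank S) (hJSS : ∀ i, (agent i).IsJSSDecomposition S) :
    IsResilientFramer graph S agent := fun _ hW _ O _ hO i =>
  ⟨O.state_framer hJac hrank hJSS hW hO i, O.input_framer hJac hrank hJSS hW hO i⟩

/-! ### Comparison functions and input-to-state stability -/

lemma classKL_geometric {c μ : ℝ} (hc : 0 < c) (hμ0 : 0 < μ) (hμ1 : μ < 1) :
    ClassKL fun r t => c * μ ^ t * r := by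
  refine ⟨?_, fun t _ => ⟨by fun_prop, fun r _ r' _ h => ?_, by simp⟩, fun r hr => ⟨?_, ?_⟩⟩
  · have : Continuous fun q : ℝ × ℝ => c * μ ^ q.2 * q.1 :=
      (continuous_const.mul (continuous_const.rpow continuous_snd fun _ => Or.inl hμ0.ne')).mul
        continuous_fst
    exact this.continuousOn
  · exact mul_lt_mul_of_pos_left h (mul_pos hc (Real.rpow_pos_of_pos hμ0 t))
  · intro t _ t' _ h
    have := Real.rpow_le_rpow_of_exponent_ge hμ0 hμ1.le h
    simp only
    gcongr
  · have := ((tendsto_rpow_atTop_of_base_lt_one μ (by linarith) hμ1).const_mul c).mul_const r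
    simpa using this

lemma classKInf_linear {c : ℝ} (hc : 0 < c) : ClassKInf fun r => c * r :=
  ⟨⟨by fun_prop, fun _ _ _ _ h => mul_lt_mul_of_pos_left h hc, mul_zero c⟩,
    Filter.tendsto_id.const_mul_atTop hc⟩

/-- A stabilizing network selection makes the observer input-to-state stable. -/
theorem isCISSObserver_of_schurStable (hJac : S.HasBoundedJacobian)
    (hrank : ∀ i, (agent i).FullColumnRank S) (hJSS : ∀ i, (agent i).IsJSSDecomposition S)
    (h : ∃ σ ∈ SigmaX n graph, SchurStable (σ * collectiveAx S agent)) :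
    IsCISSObserver graph S agent := by
  refine ⟨isResilientFramer hJac hrank hJSS, ?_⟩
  obtain ⟨σ, hσ, hS⟩ := h
  have hM := SigmaX_mul_nonneg hσ (collectiveAx_nonneg (S := S) (agent := agent))
  obtain ⟨v, μ, hv, hμ0, hμ1, hsub⟩ := hS.exists_subinvariant hM
  have hv0 : 0 ≤ v := fun a => zero_le_one.trans (hv a)
  have hμ' : 0 < 1 - μ := by linarith
  set g : Fin N × Fin n → ℝ := σ *ᵥ fun q => (agent q.1).noiseGain S q.2 with hg
  set κ : ℝ := l2norm g with hκ
  have hκ0 : 0 ≤ κ := l2norm_nonneg g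
  have hvn : 0 ≤ l2norm v := l2norm_nonneg v
  -- Both gains are linear in the amplitude; adding `1` makes them strictly increasing even if `κ`
  -- or `l2norm v` vanishes.
  refine ⟨fun r t => (l2norm v + 1) * μ ^ t * r, fun r => (κ / (1 - μ) * l2norm v + 1) * r,
    classKL_geometric (by positivity) hμ0 hμ1, classKInf_linear (by positivity), ?_⟩
  intro nb hW P O k hO
  have hδ : 0 ≤ l2norm nb.width := l2norm_nonneg _
  have hr : 0 ≤ l2norm (O.ex 0) := l2norm_nonneg _
  have hgv : l2norm nb.width • g ≤ (l2norm nb.width * κ) • v := by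
    intro a
    have h1 : g a ≤ κ * v a := by
      have := (le_abs_self _).trans (abs_le_l2norm g a)
      nlinarith [hv a]
    simp only [Pi.smul_apply, smul_eq_mul, mul_assoc]
    exact mul_le_mul_of_nonneg_left h1 hδ
  have hk := le_of_subinvariant (k := k) (e := O.ex) hM hv0 hμ0 hμ1 hsub hr
    (mul_nonneg hδ hκ0)
    (fun l hl => (O.ex_succ_le hJac hrank hJSS hW (hO.mono hl.le) hσ).trans
      (add_le_add_right hgv _))
    (fun a => ?_)
  · have hp : 0 ≤ μ ^ k * l2norm (O.ex 0) + l2norm nb.width * κ / (1 - μ) := by positivity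
    have h1 := l2norm_mono (O.ex_nonneg hJac hrank hJSS hW hO) hk
    rw [l2norm_smul hp] at h1
    have h2 : 0 ≤ μ ^ k * l2norm (O.ex 0) := by positivity
    have h3 : (μ ^ k * l2norm (O.ex 0) + l2norm nb.width * κ / (1 - μ)) * l2norm v =
        l2norm v * μ ^ k * l2norm (O.ex 0) + κ / (1 - μ) * l2norm v * l2norm nb.width := by ring
    simp only [Real.rpow_natCast]
    linarith
  · have := (le_abs_self _).trans (abs_le_l2norm (O.ex 0) a)
    simp only [Pi.smul_apply, smul_eq_mul]
    nlinarith [hv a]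

end Observer

end ResilientObserver

end

open ResilientObserver in
theorem mainTheorem1 (N n p nw : ℕ) (S : Target n p nw) (agent : Fin N → Agent n p nw)
    (graph : Digraph (Fin N))
    (hnbr : ∀ i, (nbr graph i).Nonempty)
    (hJac : S.HasBoundedJacobian)
    (hrank : ∀ i, (agent i).FullColumnRank S)
    (hJSS : ∀ i, (agent i).IsJSSDecomposition S) :
    (GloballyExponentiallyStable (IsComparisonTrajectory graph (collectiveAx S agent)) ↔
      ∃ σ ∈ SigmaX n graph, SchurStable (σ * collectiveAx S agent)) ∧
    (GloballyExponentiallyStable (IsComparisonSubtrajectory graph (collectiveAx S agent)) ↔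
      ∃ σ ∈ SigmaX n graph, SchurStable (σ * collectiveAx S agent)) ∧
    ((∃ σ ∈ SigmaX n graph, SchurStable (σ * collectiveAx S agent)) →
      IsCISSObserver graph S agent) :=
  have h := stable_iff_exists_schurStable hnbr (collectiveAx_nonneg (S := S) (agent := agent))
  ⟨h.1, h.2, isCISSObserver_of_schurStable hJac hrank hJSS⟩
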